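/- Let $a>0$, $\mu_s>0$, $\omega\in\mathbb R\setminus\{0\}$, $1<q<\infty$ and $1/q+1/q'=1$. Let $\mathsf M=\{x\in\mathbb R^3:|x|=a\}$ carry the metric $g$ induced by $\mathbb R^3$, with Levi-Civita connection $\nabla$ and area measure $\mu_g$; let $\theta$ denote the longitude and $\phi$ the colatitude, and write $(u|v)_{\mathsf M}=\int_{\mathsf M}(u|v)_g\,d\mu_g$ (also for $(1,1)$-tensor fields). Let $\mathbb P_H u=u-\operatorname{grad}\psi_u$ be the Helmholtz projection on $L_q(\mathsf M;T\mathsf M)$, where $\operatorname{grad}\psi_u\in L_q(\mathsf M;T\mathsf M)$ is the unique solution of $(\operatorname{grad}\psi_u|\operatorname{grad}\varphi)_{\mathsf M}=(u|\operatorname{grad}\varphi)_{\mathsf M}$ for all $\varphi\in \dot H^1_{q'}(\mathsf M)$. Put $L_{q,\sigma}=\mathbb P_H L_q(\mathsf M;T\mathsf M)$, $H^1_{q,\sigma}=H^1_q(\mathsf M;T\mathsf M)\cap L_{q,\sigma}$ and $H^{-1}_{q,\sigma}=(H^1_{q',\sigma})'$. Let $D_u=\tfrac12(\nabla u+(\nabla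 u)^{\mathsf T})$, and let $Cu=-2\omega\cos\phi\,Ku$, where $K$ rotates tangent vectors by $90^\circ$ counterclockwise about the outward normal. Define $A^{\mathsf w},B^{\mathsf w}:H^1_{q,\sigma}\to H^{-1}_{q,\sigma}$ by $$\langle A^{\mathsf w}u,v\rangle=2\mu_s(D_u|D_v)_{\mathsf M},\qquad \langle B^{\mathsf w}u,v\rangle=(\mathbb P_H Cu|v)_{\mathsf M},\qquad u\in H^1_{q,\sigma},\ v\in H^1_{q',\sigma}.$$ Then $$\{u\in H^1_{q,\sigma}: A^{\mathsf w}u+B^{\mathsf w}u=0\}=\Big\{c\,\frac{\partial}{\partial\theta}: c\in\mathbb R\Big\},$$ where $\partial/\partial\theta$ is the field $(x,y,z)\mapsto(-y,x,0)$; that is, the elements of the kernel are exactly the rotations about the $z$-axis. -/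

import Mathlib

open MeasureTheory Metric Set
open scoped ENNReal RealInnerProductSpace

noncomputable section

namespace SphereFlow

/-- The ambient Euclidean space `ℝ³`. -/
abbrev E3 : Type := EuclideanSpace ℝ (Fin 3)

/-- Real `3 × 3` matrices with the inner product `(S | T) = ∑ S_ij T_ij = tr(Sᵀ T)`. A
`(1,1)`-tensor on a tangent plane of the sphere is identified with the matrix of the endomorphism of
`ℝ³` that extends it by zero on the normal line; this preserves inner products and transposes. -/
abbrev T3 : Type := EuclideanSpace ℝ (Fin 3 × Fin 3)

/-- The matrix of an endomorphism of `ℝ³` in the standard basis. -/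
def toTensor (S : E3 →L[ℝ] E3) : T3 :=
  WithLp.toLp 2 fun ij => S (EuclideanSpace.single ij.2 (1 : ℝ)) ij.1

/-! ### The round sphere of radius `a` -/

/-- The area measure `μ_g` of the sphere of radius `a` centred at the origin, as a measure on `ℝ³`
that is carried by the sphere: the image under `x ↦ a x` of the area measure of the unit sphere,
multiplied by `a ^ 2`. -/
def area (a : ℝ) : Measure E3 :=
  ENNReal.ofReal (a ^ 2) •
    (volume : Measure E3).toSphere.map (fun x : sphere (0 : E3) 1 => a • (x : E3))

instance area_isFiniteMeasure (a : ℝ) : IsFiniteMeasure (area a) := by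
  unfold area
  exact Measure.smul_finite _ ENNReal.ofReal_ne_top

theorem ae_mem_sphere {a : ℝ} : ∀ᵐ x ∂(area a), x ∈ sphere (0 : E3) |a| := by
  unfold area
  refine Measure.ae_smul_measure ?_ _
  refine (ae_map_iff (p := fun x : E3 => x ∈ sphere (0 : E3) |a|) (by fun_prop)
    isClosed_sphere.measurableSet).2 ?_
  refine Filter.Eventually.of_forall fun x => ?_
  have hx : ‖(x : E3)‖ = 1 := by simp
  simp [norm_smul, hx]

theorem memLp_of_continuous {F : Type*} [NormedAddCommGroup F] (a : ℝ) (q : ℝ≥0∞)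
    {f : E3 → F} (hf : Continuous f) [SecondCountableTopologyEither E3 F] :
    MemLp f q (area a) := by
  obtain ⟨C, hC⟩ := (isCompact_sphere (0 : E3) |a|).exists_bound_of_continuousOn hf.continuousOn
  refine MemLp.of_bound hf.aestronglyMeasurable C ?_
  filter_upwards [ae_mem_sphere] with x hx using hC x hx

/-- The orthogonal projection of `ℝ³` onto the plane tangent to the sphere of radius `a` at the
point `x` of this sphere. -/
def tangentProj (a : ℝ) (x : E3) : E3 →L[ℝ] E3 :=
  ContinuousLinearMap.id ℝ E3 - (a ^ 2)⁻¹ • (innerSL ℝ x).smulRight x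

/-- The vector product in `ℝ³`. -/
def cross (x v : E3) : E3 := WithLp.toLp 2 (crossProduct (WithLp.ofLp x) (WithLp.ofLp v))

/-! ### Smooth tangential fields, covariant derivative, gradient -/

/-- Smooth tangential vector fields on the sphere of radius `a`, given as restrictions of smooth
maps of `ℝ³`. -/
structure IsSmoothField (a : ℝ) (U : E3 → E3) : Prop where
  smooth : ContDiff ℝ ((⊤ : ℕ∞) : WithTop ℕ∞) U
  tangent : ∀ x ∈ sphere (0 : E3) a, ⟪x, U x⟫ = 0

/-- The covariant derivative `∇U` (Levi-Civita connection of the sphere): for tangent `ξ`,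
`∇_ξ U` is the tangential part of the directional derivative of `U` along `ξ`. -/
def covDeriv (a : ℝ) (U : E3 → E3) (x : E3) : T3 :=
  toTensor (tangentProj a x ∘L fderiv ℝ U x ∘L tangentProj a x)

/-- The surface gradient of (the restriction to the sphere of) a function. -/
def surfaceGrad (a : ℝ) (Φ : E3 → ℝ) (x : E3) : E3 := tangentProj a x (gradient Φ x)

theorem continuous_tangentProj (a : ℝ) : Continuous (tangentProj a) := by
  unfold tangentProj
  have h : Continuous (fun x : E3 => (innerSL ℝ x).smulRight x) :=
    ((ContinuousLinearMap.smulRightL ℝ E3 E3).continuous₂).comp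
      ((innerSL ℝ).continuous.prodMk continuous_id)
  exact continuous_const.sub (h.const_smul ((a ^ 2)⁻¹))

theorem continuous_covDeriv (a : ℝ) {U : E3 → E3}
    (hU : ContDiff ℝ ((⊤ : ℕ∞) : WithTop ℕ∞) U) : Continuous (covDeriv a U) := by
  have h : Continuous fun x => tangentProj a x ∘L fderiv ℝ U x ∘L tangentProj a x :=
    (continuous_tangentProj a).clm_comp
    ((hU.continuous_fderiv (by simp)).clm_comp (continuous_tangentProj a))
  refine (PiLp.continuous_toLp 2 _).comp (continuous_pi fun ij => ?_)
  exact (EuclideanSpace.proj (𝕜 := ℝ) ij.1).continuous.comp (h.clm_apply continuous_const)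

theorem covDeriv_add (a : ℝ) {U V : E3 → E3} (hU : ContDiff ℝ ((⊤ : ℕ∞) : WithTop ℕ∞) U)
    (hV : ContDiff ℝ ((⊤ : ℕ∞) : WithTop ℕ∞) V) (x : E3) :
    covDeriv a (U + V) x = covDeriv a U x + covDeriv a V x := by
  have h : fderiv ℝ (U + V) x = fderiv ℝ U x + fderiv ℝ V x :=
    fderiv_add (hU.differentiable (by simp) x) (hV.differentiable (by simp) x)
  ext ij
  simp [covDeriv, toTensor, h]

theorem covDeriv_smul (a c : ℝ) {U : E3 → E3} (hU : ContDiff ℝ ((⊤ : ℕ∞) : WithTop ℕ∞) U)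
    (x : E3) : covDeriv a (c • U) x = c • covDeriv a U x := by
  have h : fderiv ℝ (c • U) x = c • fderiv ℝ U x :=
    fderiv_const_smul (hU.differentiable (by simp) x) c
  ext ij
  simp [covDeriv, toTensor, h]

theorem surfaceGrad_add (a : ℝ) {Φ Ψ : E3 → ℝ} (hΦ : ContDiff ℝ ((⊤ : ℕ∞) : WithTop ℕ∞) Φ)
    (hΨ : ContDiff ℝ ((⊤ : ℕ∞) : WithTop ℕ∞) Ψ) (x : E3) :
    surfaceGrad a (Φ + Ψ) x = surfaceGrad a Φ x + surfaceGrad a Ψ x := by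
  have h : fderiv ℝ (Φ + Ψ) x = fderiv ℝ Φ x + fderiv ℝ Ψ x :=
    fderiv_add (hΦ.differentiable (by simp) x) (hΨ.differentiable (by simp) x)
  simp [surfaceGrad, gradient, h]

theorem surfaceGrad_smul (a c : ℝ) {Φ : E3 → ℝ} (hΦ : ContDiff ℝ ((⊤ : ℕ∞) : WithTop ℕ∞) Φ)
    (x : E3) : surfaceGrad a (c • Φ) x = c • surfaceGrad a Φ x := by
  have h : fderiv ℝ (c • Φ) x = c • fderiv ℝ Φ x :=
    fderiv_const_smul (hΦ.differentiable (by simp) x) c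
  simp [surfaceGrad, gradient, h]

/-! ### Lebesgue and Sobolev spaces -/

/-- `L_q(M; TM)`: the `L_q` fields that are tangential almost everywhere. -/
def LqTangent (a : ℝ) (q : ℝ≥0∞) : Submodule ℝ (Lp E3 q (area a)) where
  carrier := {u | ∀ᵐ x ∂(area a), ⟪x, u x⟫ = 0}
  zero_mem' := by
    change ∀ᵐ x ∂(area a), ⟪x, (0 : Lp E3 q (area a)) x⟫ = 0
    filter_upwards [Lp.coeFn_zero E3 q (area a)] with x hx
    rw [hx]
    simp
  add_mem' := by
    intro u v hu hv
    change ∀ᵐ x ∂(area a), ⟪x, (u + v) x⟫ = 0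
    filter_upwards [Lp.coeFn_add u v, hu, hv] with x hx h1 h2
    rw [hx, Pi.add_apply, inner_add_right, h1, h2, add_zero]
  smul_mem' := by
    intro c u hu
    change ∀ᵐ x ∂(area a), ⟪x, (c • u) x⟫ = 0
    filter_upwards [Lp.coeFn_smul c u, hu] with x hx h1
    rw [hx, Pi.smul_apply, inner_smul_right, h1, mul_zero]

/-- The pairs `(U, ∇U)` with `U` a smooth tangential field. -/
def smoothFieldPairs (a : ℝ) (q : ℝ≥0∞) :
    Submodule ℝ (Lp E3 q (area a) × Lp T3 q (area a)) where
  carrier := {p | ∃ U : E3 → E3, IsSmoothField a U ∧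
    p.1 =ᵐ[area a] U ∧ p.2 =ᵐ[area a] covDeriv a U}
  zero_mem' := by
    refine ⟨0, ⟨contDiff_const, by simp⟩, Lp.coeFn_zero E3 q (area a), ?_⟩
    filter_upwards [Lp.coeFn_zero T3 q (area a)] with x hx
    refine hx.trans ?_
    ext ij
    simp [covDeriv, toTensor]
  add_mem' := by
    rintro p r ⟨U, hU, h1, h2⟩ ⟨V, hV, k1, k2⟩
    refine ⟨U + V, ⟨hU.smooth.add hV.smooth, fun x hx => ?_⟩, ?_, ?_⟩
    · simp [inner_add_right, hU.tangent x hx, hV.tangent x hx]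
    · filter_upwards [Lp.coeFn_add p.1 r.1, h1, k1] with x hx h k
      rw [Prod.fst_add, hx, Pi.add_apply, h, k, Pi.add_apply]
    · filter_upwards [Lp.coeFn_add p.2 r.2, h2, k2] with x hx h k
      rw [Prod.snd_add, hx, Pi.add_apply, h, k, covDeriv_add a hU.smooth hV.smooth]
  smul_mem' := by
    rintro c p ⟨U, hU, h1, h2⟩
    refine ⟨c • U, ⟨contDiff_const.smul hU.smooth, fun x hx => ?_⟩, ?_, ?_⟩
    · simp [inner_smul_right, hU.tangent x hx]
    · filter_upwards [Lp.coeFn_smul c p.1, h1] with x hx h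
      simp [hx, h]
    · filter_upwards [Lp.coeFn_smul c p.2, h2] with x hx h
      simp [hx, h, covDeriv_smul a c hU.smooth]

/-- The Sobolev space `H¹_q(M; TM)`: the completion of the smooth tangential fields in the norm of
`‖u‖_{L_q} + ‖∇u‖_{L_q}`. An element is the pair `(u, ∇u)` of a field and its covariant
derivative. -/
def H1 (a : ℝ) (q : ℝ≥0∞) [Fact (1 ≤ q)] :
    Submodule ℝ (Lp E3 q (area a) × Lp T3 q (area a)) :=
  (smoothFieldPairs a q).topologicalClosure

/-- The pairs `(Φ, grad Φ)` with `Φ` a smooth function. -/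
def smoothScalarPairs (a : ℝ) (q : ℝ≥0∞) :
    Submodule ℝ (Lp ℝ q (area a) × Lp E3 q (area a)) where
  carrier := {p | ∃ Φ : E3 → ℝ, ContDiff ℝ ((⊤ : ℕ∞) : WithTop ℕ∞) Φ ∧
    p.1 =ᵐ[area a] Φ ∧ p.2 =ᵐ[area a] surfaceGrad a Φ}
  zero_mem' := by
    refine ⟨0, contDiff_const, Lp.coeFn_zero ℝ q (area a), ?_⟩
    filter_upwards [Lp.coeFn_zero E3 q (area a)] with x hx
    simpa [surfaceGrad, gradient] using hx
  add_mem' := by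
    rintro p r ⟨U, hU, h1, h2⟩ ⟨V, hV, k1, k2⟩
    refine ⟨U + V, hU.add hV, ?_, ?_⟩
    · filter_upwards [Lp.coeFn_add p.1 r.1, h1, k1] with x hx h k
      rw [Prod.fst_add, hx, Pi.add_apply, h, k, Pi.add_apply]
    · filter_upwards [Lp.coeFn_add p.2 r.2, h2, k2] with x hx h k
      rw [Prod.snd_add, hx, Pi.add_apply, h, k, surfaceGrad_add a hU hV]
  smul_mem' := by
    rintro c p ⟨U, hU, h1, h2⟩
    refine ⟨c • U, contDiff_const.smul hU, ?_, ?_⟩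
    · filter_upwards [Lp.coeFn_smul c p.1, h1] with x hx h
      simp [hx, h]
    · filter_upwards [Lp.coeFn_smul c p.2, h2] with x hx h
      simp [hx, h, surfaceGrad_smul a c hU]

/-- The scalar Sobolev space `H¹_q(M)`, with elements the pairs `(φ, grad φ)`. On the compact
sphere the homogeneous space consists of the same functions, taken modulo constants. -/
def H1Scalar (a : ℝ) (q : ℝ≥0∞) [Fact (1 ≤ q)] :
    Submodule ℝ (Lp ℝ q (area a) × Lp E3 q (area a)) :=
  (smoothScalarPairs a q).topologicalClosure

/-! ### Duality pairings -/

/-- `(u | v)_M = ∫_M (u | v)_g dμ_g` on `L_q × L_{q'}`, for vector fields. -/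
def fieldPairing (a : ℝ) (q q' : ℝ≥0∞) [Fact (1 ≤ q)] [Fact (1 ≤ q')] [q.HolderConjugate q'] :
    Lp E3 q (area a) →L[ℝ] Lp E3 q' (area a) →L[ℝ] ℝ :=
  (innerSL ℝ).lpPairing (area a) q q'

/-- `(S | T)_M = ∫_M (S | T)_g dμ_g` on `L_q × L_{q'}`, for tensor fields. -/
def tensorPairing (a : ℝ) (q q' : ℝ≥0∞) [Fact (1 ≤ q)] [Fact (1 ≤ q')] [q.HolderConjugate q'] :
    Lp T3 q (area a) →L[ℝ] Lp T3 q' (area a) →L[ℝ] ℝ :=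
  (innerSL ℝ).lpPairing (area a) q q'

/-! ### Helmholtz projection and solenoidal fields -/

/-- The graph of the Helmholtz projection on `L_q(M; TM)`: the pairs `(u, u - grad ψ)` with
`ψ ∈ H¹_q` and `(grad ψ | grad φ)_M = (u | grad φ)_M` for all `φ ∈ H¹_{q'}`. -/
def helmholtzGraph (a : ℝ) (q q' : ℝ≥0∞) [Fact (1 ≤ q)] [Fact (1 ≤ q')] [q.HolderConjugate q'] :
    Submodule ℝ (Lp E3 q (area a) × Lp E3 q (area a)) where
  carrier := {p | p.1 ∈ LqTangent a q ∧ ∃ ψ ∈ H1Scalar a q, p.2 = p.1 - ψ.2 ∧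
    ∀ φ ∈ H1Scalar a q', fieldPairing a q q' ψ.2 φ.2 = fieldPairing a q q' p.1 φ.2}
  zero_mem' := ⟨Submodule.zero_mem _, 0, Submodule.zero_mem _, by simp, by simp⟩
  add_mem' := by
    rintro p r ⟨hp, ψ, hψ, h1, h2⟩ ⟨hr, χ, hχ, k1, k2⟩
    refine ⟨Submodule.add_mem _ hp hr, ψ + χ, Submodule.add_mem _ hψ hχ, ?_, fun φ hφ => ?_⟩
    · simp only [Prod.snd_add, Prod.fst_add, h1, k1]
      abel
    · simp only [Prod.snd_add, Prod.fst_add, map_add, add_apply, h2 φ hφ,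
        k2 φ hφ]
  smul_mem' := by
    rintro c p ⟨hp, ψ, hψ, h1, h2⟩
    refine ⟨Submodule.smul_mem _ c hp, c • ψ, Submodule.smul_mem _ c hψ, ?_, fun φ hφ => ?_⟩
    · simp only [Prod.smul_snd, Prod.smul_fst, h1, smul_sub]
    · simp only [Prod.smul_snd, Prod.smul_fst, map_smul, smul_apply, h2 φ hφ]

open Classical in
/-- The Helmholtz projection `P_H u = u - grad ψ_u` on `L_q(M; TM)`. -/
def helmholtzProj (a : ℝ) (q q' : ℝ≥0∞) [Fact (1 ≤ q)] [Fact (1 ≤ q')] [q.HolderConjugate q']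
    (u : Lp E3 q (area a)) : Lp E3 q (area a) :=
  if h : ∃ w, (u, w) ∈ helmholtzGraph a q q' then h.choose else 0

/-- `L_{q,σ}(M; TM) = P_H L_q(M; TM)`, the range of the Helmholtz projection. -/
def LqSol (a : ℝ) (q q' : ℝ≥0∞) [Fact (1 ≤ q)] [Fact (1 ≤ q')] [q.HolderConjugate q'] :
    Submodule ℝ (Lp E3 q (area a)) :=
  (helmholtzGraph a q q').map (LinearMap.snd ℝ _ _)

/-- `H¹_{q,σ}(M; TM) = H¹_q(M; TM) ∩ L_{q,σ}(M; TM)`. -/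
def H1Sol (a : ℝ) (q q' : ℝ≥0∞) [Fact (1 ≤ q)] [Fact (1 ≤ q')] [q.HolderConjugate q'] :
    Submodule ℝ (Lp E3 q (area a) × Lp T3 q (area a)) :=
  H1 a q ⊓ (LqSol a q q').comap (LinearMap.fst ℝ _ _)

/-- `H⁻¹_{q,σ}(M; TM)`, the dual space of `H¹_{q',σ}(M; TM)`. -/
abbrev HNeg1Sol (a : ℝ) (q q' : ℝ≥0∞) [Fact (1 ≤ q)] [Fact (1 ≤ q')] [q.HolderConjugate q'] :
    Type :=
  H1Sol a q' q →L[ℝ] ℝ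

/-! ### The weak Stokes operator -/

/-- The symmetric part `(S + Sᵀ) / 2` of a tensor. -/
def symPart : T3 →L[ℝ] T3 :=
  LinearMap.toContinuousLinearMap
    { toFun := fun S => WithLp.toLp 2 fun ij => (S (ij.1, ij.2) + S (ij.2, ij.1)) / 2
      map_add' := fun S T => by
        ext ij
        simp
        ring
      map_smul' := fun c S => by
        ext ij
        simp
        ring }

/-- The deformation tensor `D_u = (∇u + (∇u)ᵀ) / 2` of `u ∈ H¹_{q,σ}(M; TM)`. -/
def deformation (a : ℝ) (q q' : ℝ≥0∞) [Fact (1 ≤ q)] [Fact (1 ≤ q')] [q.HolderConjugate q'] :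
    H1Sol a q q' →L[ℝ] Lp T3 q (area a) :=
  symPart.compLpL q (area a) ∘L ContinuousLinearMap.snd ℝ _ _ ∘L (H1Sol a q q').subtypeL

/-- The weak Stokes operator `A^w : H¹_{q,σ}(M; TM) → H⁻¹_{q,σ}(M; TM)`,
`⟨A^w u, v⟩ = 2 μ_s (D_u | D_v)_M`. -/
def weakStokes (a μs : ℝ) (q q' : ℝ≥0∞) [Fact (1 ≤ q)] [Fact (1 ≤ q')] [q.HolderConjugate q'] : H1Sol a q q' →L[ℝ] HNeg1Sol a q q' :=
  (2 * μs) • (tensorPairing a q q').bilinearComp (deformation a q q') (deformation a q' q)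

/-! ### The Coriolis term -/

/-- The rotation operator `K` at the point `x` of the sphere of radius `a`: counterclockwise
rotation of tangent vectors by a right angle, about the outward normal `x / a`. -/
def rotK (a : ℝ) (x v : E3) : E3 := cross (a⁻¹ • x) v

/-- The Coriolis term `C v = -2 ω cos φ K v` at the point `x`, where the cosine of the colatitude
is `cos φ = x₃ / a`. -/
def coriolisAt (a ω : ℝ) (x v : E3) : E3 := (-2 * ω * (x 2 / a)) • rotK a x v

theorem continuous_coriolisAt (a ω : ℝ) :
    Continuous (fun p : E3 × E3 => coriolisAt a ω p.1 p.2) := by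
  unfold coriolisAt rotK cross
  have h0 : Continuous (fun p : E3 × E3 => -2 * ω * (p.1 2 / a)) := by fun_prop
  refine h0.smul ?_
  refine (PiLp.continuous_toLp 2 _).comp ?_
  refine continuous_pi fun i => ?_
  fin_cases i <;> simp [cross_apply] <;> fun_prop

theorem norm_cross_le (x v : E3) : ‖cross x v‖ ≤ ‖x‖ * ‖v‖ := by
  refine le_of_sq_le_sq ?_ (by positivity)
  rw [mul_pow, EuclideanSpace.norm_sq_eq, EuclideanSpace.norm_sq_eq, EuclideanSpace.norm_sq_eq]
  simp only [Fin.sum_univ_three, cross, cross_apply, Real.norm_eq_abs, sq_abs]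
  simp
  nlinarith [sq_nonneg (x 0 * v 0 + x 1 * v 1 + x 2 * v 2)]

theorem norm_coriolisAt_le (a ω : ℝ) (x v : E3) :
    ‖coriolisAt a ω x v‖ ≤ |(-2 * ω * (x 2 / a))| * (‖a⁻¹ • x‖ * ‖v‖) := by
  unfold coriolisAt rotK
  rw [norm_smul, Real.norm_eq_abs]
  gcongr
  exact norm_cross_le _ _

theorem memLp_coriolis (a ω : ℝ) (q : ℝ≥0∞) (u : Lp E3 q (area a)) :
    MemLp (fun x => coriolisAt a ω x (u x)) q (area a) := by
  obtain ⟨C, hC⟩ := (isCompact_sphere (0 : E3) |a|).exists_bound_of_continuousOn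
    (f := fun x : E3 => |(-2 * ω * (x 2 / a))| * ‖a⁻¹ • x‖) (by fun_prop)
  refine MemLp.of_le_mul (c := C) (Lp.memLp u) ?_ ?_
  · exact (continuous_coriolisAt a ω).comp_aestronglyMeasurable
      (continuous_id.aestronglyMeasurable.prodMk (Lp.aestronglyMeasurable u))
  · filter_upwards [ae_mem_sphere] with x hx
    refine (norm_coriolisAt_le a ω x (u x)).trans ?_
    rw [← mul_assoc]
    gcongr
    exact (le_abs_self _).trans (hC x hx)

/-- The Coriolis operator `C` on `L_q` fields. -/
def coriolis (a ω : ℝ) (q : ℝ≥0∞) (u : Lp E3 q (area a)) : Lp E3 q (area a) :=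
  (memLp_coriolis a ω q u).toLp _

/-- The weak Coriolis operator `B^w : H¹_{q,σ}(M; TM) → H⁻¹_{q,σ}(M; TM)`,
`⟨B^w u, φ⟩ = (P_H C u | φ)_M`. -/
def weakCoriolis (a ω : ℝ) (q q' : ℝ≥0∞) [Fact (1 ≤ q)] [Fact (1 ≤ q')] [q.HolderConjugate q']
    (u : H1Sol a q q') : HNeg1Sol a q q' :=
  fieldPairing a q q' (helmholtzProj a q q' (coriolis a ω q u.1.1)) ∘L
    ContinuousLinearMap.fst ℝ _ _ ∘L (H1Sol a q' q).subtypeL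

/-- The null space `N(A^w + B^w)`, as a subset of the space of pairs `(u, ∇u)`. -/
def weakKernel (a μs ω : ℝ) (q q' : ℝ≥0∞) [Fact (1 ≤ q)] [Fact (1 ≤ q')]
    [q.HolderConjugate q'] :
    Set (Lp E3 q (area a) × Lp T3 q (area a)) :=
  Subtype.val '' {u : H1Sol a q q' | weakStokes a μs q q' u + weakCoriolis a ω q q' u = 0}

/-! ### Rotations about the `z`-axis -/

/-- The point of the sphere of radius `a` with longitude `θ` and colatitude `φ`. -/
def sphericalPoint (a θ φ : ℝ) : E3 :=
  !₂[a * Real.sin φ * Real.cos θ, a * Real.sin φ * Real.sin θ, a * Real.cos φ]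

/-- The coordinate field `∂/∂θ`, extended smoothly over the poles: at `(x, y, z)` it is
`(-y, x, 0)`. -/
def dTheta (x : E3) : E3 := !₂[-(x 1), x 0, 0]

/-- `dTheta` is the derivative of the spherical coordinates with respect to the longitude. -/
theorem hasDerivAt_sphericalPoint (a θ φ : ℝ) :
    HasDerivAt (fun t => sphericalPoint a t φ) (dTheta (sphericalPoint a θ φ)) θ := by
  have h : HasDerivAt (fun t : ℝ => (![a * Real.sin φ * Real.cos t, a * Real.sin φ * Real.sin t,
      a * Real.cos φ] : Fin 3 → ℝ))
      ![-(a * Real.sin φ * Real.sin θ), a * Real.sin φ * Real.cos θ, 0] θ := by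
    refine hasDerivAt_pi.2 fun i => ?_
    fin_cases i
    · simpa using (Real.hasDerivAt_cos θ).const_mul (a * Real.sin φ)
    · simpa using (Real.hasDerivAt_sin θ).const_mul (a * Real.sin φ)
    · simpa using hasDerivAt_const θ (a * Real.cos φ)
  exact ((PiLp.continuousLinearEquiv 2 ℝ (fun _ : Fin 3 => ℝ)).symm.hasFDerivAt).comp_hasDerivAt θ h

theorem contDiff_dTheta : ContDiff ℝ ((⊤ : ℕ∞) : WithTop ℕ∞) dTheta := by
  rw [contDiff_euclidean]
  intro i
  fin_cases i <;> simp [dTheta] <;> fun_prop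

/-- The field `∂/∂θ` together with its covariant derivative. -/
def dThetaPair (a : ℝ) (q : ℝ≥0∞) : Lp E3 q (area a) × Lp T3 q (area a) :=
  ((memLp_of_continuous a q contDiff_dTheta.continuous).toLp dTheta,
   (memLp_of_continuous a q (continuous_covDeriv a contDiff_dTheta)).toLp (covDeriv a dTheta))

/-- The set of equilibria `{c ∂/∂θ : c ∈ ℝ}`. -/
def equilibria (a : ℝ) (q : ℝ≥0∞) : Set (Lp E3 q (area a) × Lp T3 q (area a)) :=
  {p | ∃ c : ℝ, p = c • dThetaPair a q}

end SphereFlow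

end

/-! The kernel equation is tested with the rotational fields x × ∇P, P a polynomial, and turned into
a statement about the functional ℓ(P) = ∫ u · (x × ∇P). Write ∂ₘ = (x × ∇)ₘ (`lie`) and L = ∑ ∂ₘ²
(`lieSq`), which on spheres is the Laplace-Beltrami operator of the unit sphere.

Twice the deformation tensor of x × ∇P has divergence a⁻² x × ∇(L + 2)P, so the Stokes part is -(μs
/ a²) ℓ((L + 2)P). As u is tangential and divergence-free, the Coriolis part is 2ω ∫ u_z P. With LP
in place of P, the identity `single_lieSq` turns ∫ u_z LP into ℓ(∂P), where ∂ is the derivation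
about the z-axis. Hence ℓ vanishes on (L + 2)LP + c ∂P with c = -2ωa² / μs.

On homogeneous polynomials of degree n, L is -n(n + 1) up to |x|² times degree n - 2, and |x|² = a²
on the sphere. For n ≥ 2 the leading part of (L + 2)L + c ∂ is a nonzero scalar plus a skew
operator, hence onto. By induction on the degree, such a functional is zero as soon as it is zero in
degrees 0 and 1 (`eq_zero_of_stokes_coriolis`); no decomposition into spherical harmonics is needed.
In degree one (L + 2)L = 0, so only c ℓ(∂P) = 0 is left, which gives ℓ(x) = ℓ(y) = 0. Subtracting a
multiple of ∂/∂θ makes ℓ zero, and a solenoidal field with ℓ = 0 vanishes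
(`IsSolenoidal.ae_eq_zero`, from `single_lieSq` and Stone-Weierstrass). The pair (u, ∇u) is then
determined by u (`snd_eq_zero_of_mem_H1`).

`helmholtzProj` takes the value 0 where no decomposition exists, so a decomposition of Cu has to be
produced. If there were none, the equation would be the pure Stokes equation and u a rotation field,
whose Coriolis term decomposes explicitly.

Conversely, ∂/∂θ has zero deformation tensor and its Coriolis term is the gradient of -ωz², which is
orthogonal to solenoidal fields. -/

noncomputable section

namespace SphereFlow

open scoped Pointwise

open MvPolynomial (X C pderiv)

/-! ### Invariance of the area measure under rotations -/

/-- The surface measure of a set is three times the volume of the cone over it, and `R` carries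
cones to cones and preserves volume. -/
theorem toSphere_preimage_isometry (R : E3 ≃ₗᵢ[ℝ] E3) {s : Set (sphere (0 : E3) 1)}
    {t : Set (sphere (0 : E3) 1)} (hs : MeasurableSet s) (ht : MeasurableSet t)
    (h : (fun x => R x) '' ((↑) '' s : Set E3) = (↑) '' t) :
    (volume : Measure E3).toSphere t = (volume : Measure E3).toSphere s := by
  rw [Measure.toSphere_apply' _ hs, Measure.toSphere_apply' _ ht, ← h]
  congr 1
  have h2 : Ioo (0 : ℝ) 1 • ((fun x => R x) '' ((↑) '' s : Set E3))
      = R.symm ⁻¹' (Ioo (0 : ℝ) 1 • ((↑) '' s : Set E3)) := by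
    ext y
    simp only [Set.mem_smul, mem_image, mem_preimage]
    constructor
    · rintro ⟨r, hr, _, ⟨z, hz, rfl⟩, rfl⟩
      exact ⟨r, hr, z, hz, by simp⟩
    · rintro ⟨r, hr, z, hz, hy⟩
      refine ⟨r, hr, R z, ⟨z, hz, rfl⟩, ?_⟩
      rw [← map_smul, hy, LinearIsometryEquiv.apply_symm_apply]
  rw [h2]
  exact R.symm.measurePreserving.measure_preimage_emb
    R.symm.toHomeomorph.measurableEmbedding _

theorem map_area_isometry (a : ℝ) (R : E3 ≃ₗᵢ[ℝ] E3) : (area a).map R = area a := by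
  have hm : Measurable (fun x : sphere (0 : E3) 1 => a • (x : E3)) := by fun_prop
  unfold area
  rw [Measure.map_smul]
  congr 1
  ext s hs
  have hR : Measurable (R : E3 → E3) := R.continuous.measurable
  rw [Measure.map_apply hR hs, Measure.map_apply hm (hR hs), Measure.map_apply hm hs]
  refine (toSphere_preimage_isometry R (hm (hR hs)) (hm hs) ?_).symm
  ext y
  simp only [mem_image, mem_preimage, Subtype.exists, mem_sphere_iff_norm, sub_zero]
  constructor
  · rintro ⟨_, ⟨z, hz, hzs, rfl⟩, rfl⟩
    exact ⟨R z, by simpa using hz, by simpa using hzs, rfl⟩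
  · rintro ⟨z, hz, hzs, rfl⟩
    exact ⟨R.symm z, ⟨R.symm z, by simpa using hz, by simpa [← map_smul] using hzs, rfl⟩, by simp⟩

/-- The generator `x ↦ e_m × x` of the rotations about the `m`-th axis. -/
def rotGen (m : Fin 3) (x : E3) : E3 :=
  x (m + 1) • EuclideanSpace.single (m + 2) (1 : ℝ) - x (m + 2) • EuclideanSpace.single (m + 1) 1

/-- The rotation by the angle `t` about the `m`-th axis. -/
def rotFun (m : Fin 3) (t : ℝ) (x : E3) : E3 :=
  x + (Real.cos t - 1) • (x (m + 1) • EuclideanSpace.single (m + 1) (1 : ℝ)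
    + x (m + 2) • EuclideanSpace.single (m + 2) 1) + Real.sin t • rotGen m x

/-- The rotation by the angle `t` about the `m`-th axis, as a linear isometry. -/
def rotIsometry (m : Fin 3) (t : ℝ) : E3 →ₗᵢ[ℝ] E3 where
  toFun := rotFun m t
  map_add' x y := by
    simp only [rotFun, rotGen, PiLp.add_apply]
    module
  map_smul' c x := by
    simp only [rotFun, rotGen, PiLp.smul_apply, smul_eq_mul, RingHom.id_apply]
    module
  norm_map' x := by
    have h := Real.sin_sq_add_cos_sq t
    change ‖rotFun m t x‖ = ‖x‖
    rw [← sq_eq_sq₀ (norm_nonneg _) (norm_nonneg _), EuclideanSpace.norm_sq_eq,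
      EuclideanSpace.norm_sq_eq]
    simp only [Fin.sum_univ_three, Real.norm_eq_abs, sq_abs]
    fin_cases m <;> simp [rotFun, rotGen]
    · linear_combination (x 1 ^ 2 + x 2 ^ 2) * h
    · linear_combination (x 2 ^ 2 + x 0 ^ 2) * h
    · linear_combination (x 0 ^ 2 + x 1 ^ 2) * h

theorem integral_rotFun (a : ℝ) (m : Fin 3) (t : ℝ) (F : E3 → ℝ) :
    ∫ x, F (rotFun m t x) ∂(area a) = ∫ x, F x ∂(area a) := by
  let R : E3 ≃ₗᵢ[ℝ] E3 := (rotIsometry m t).toLinearIsometryEquiv rfl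
  have h := map_area_isometry a R
  conv_rhs => rw [← h]
  exact (R.toHomeomorph.measurableEmbedding.integral_map F).symm

theorem hasDerivAt_rotFun (m : Fin 3) (x : E3) (t : ℝ) :
    HasDerivAt (fun t => rotFun m t x)
      (-Real.sin t • (x (m + 1) • EuclideanSpace.single (m + 1) (1 : ℝ)
    + x (m + 2) • EuclideanSpace.single (m + 2) 1) + Real.cos t • rotGen m x) t := by
  unfold rotFun
  exact ((((Real.hasDerivAt_cos t).sub_const 1).smul_const _).const_add x).add
    ((Real.hasDerivAt_sin t).smul_const _)

theorem continuous_rotGen (m : Fin 3) : Continuous (rotGen m) := by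
  unfold rotGen
  fun_prop

theorem integrable_area_of_continuous (a : ℝ) {F : E3 → ℝ} (hF : Continuous F) :
    Integrable F (area a) :=
  memLp_one_iff_integrable.1 (memLp_of_continuous a 1 hF)

/-- The derivative of a function along a rotation has vanishing integral over the sphere. -/
theorem integral_fderiv_rotGen (a : ℝ) (m : Fin 3) {F : E3 → ℝ}
    (hF : ContDiff ℝ ((⊤ : ℕ∞) : WithTop ℕ∞) F) :
    ∫ x, fderiv ℝ F x (rotGen m x) ∂(area a) = 0 := by
  have hd : ∀ x, DifferentiableAt ℝ F x := hF.differentiable (by simp)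
  have hc : Continuous (fderiv ℝ F) := hF.continuous_fderiv (by simp)
  let G : ℝ × E3 → E3 := fun p => -Real.sin p.1 • (p.2 (m + 1) •
    EuclideanSpace.single (m + 1) (1 : ℝ) + p.2 (m + 2) • EuclideanSpace.single (m + 2) 1)
    + Real.cos p.1 • rotGen m p.2
  have hG : Continuous G := by
    have := continuous_rotGen m
    fun_prop
  have hrot : Continuous (fun p : ℝ × E3 => rotFun m p.1 p.2) := by
    have := continuous_rotGen m
    unfold rotFun
    fun_prop
  let F' : ℝ → E3 → ℝ := fun t x => fderiv ℝ F (rotFun m t x) (G (t, x))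
  have hF'c : Continuous (fun p : ℝ × E3 => F' p.1 p.2) :=
    (hc.comp hrot).clm_apply hG
  -- `B` bounds the derivative for |t| ≤ 1 on the sphere, which permits differentiation under the
  -- integral at t = 0.
  obtain ⟨B, hB⟩ := ((isCompact_closedBall (0 : ℝ) 1).prod
    (isCompact_sphere (0 : E3) |a|)).exists_bound_of_continuousOn hF'c.continuousOn
  have key := hasDerivAt_integral_of_dominated_loc_of_deriv_le (μ := area a) (𝕜 := ℝ)
    (F := fun t x => F (rotFun m t x)) (F' := F') (x₀ := 0) (s := ball 0 1) (bound := fun _ => B)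
    (ball_mem_nhds 0 one_pos)
    (Filter.Eventually.of_forall fun t =>
      (hF.continuous.comp (hrot.comp (Continuous.prodMk_right t))).aestronglyMeasurable)
    (integrable_area_of_continuous a
      (hF.continuous.comp (hrot.comp (Continuous.prodMk_right 0))))
    (hF'c.comp (Continuous.prodMk_right 0)).aestronglyMeasurable
    (by
      filter_upwards [ae_mem_sphere] with x hx t ht
      exact hB (t, x) ⟨ball_subset_closedBall ht, hx⟩)
    (integrable_const _)
    (Filter.Eventually.of_forall fun x t _ =>
      (hd _).hasFDerivAt.comp_hasDerivAt t (hasDerivAt_rotFun m x t))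
  have h1 := key.2
  -- By rotation invariance the integral does not depend on t, so its derivative is zero.
  simp only [integral_rotFun] at h1
  have h2 := h1.unique (hasDerivAt_const (0 : ℝ) _)
  simpa [F', G, rotFun] using h2

/-! ### Polynomial functions on the sphere -/

/-- Polynomials in the Cartesian coordinates of `ℝ³`. -/
abbrev Poly : Type := MvPolynomial (Fin 3) ℝ

/-- Evaluation of polynomials at a point of `ℝ³`. -/
def ev (x : E3) : Poly →ₐ[ℝ] ℝ := MvPolynomial.aeval fun i => x i

@[simp]
theorem ev_X (x : E3) (i : Fin 3) : ev x (X i) = x i := by simp [ev]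

@[simp]
theorem ev_C (x : E3) (c : ℝ) : ev x (C c) = c := by simp [ev]

theorem contDiff_ev (P : Poly) : ContDiff ℝ ((⊤ : ℕ∞) : WithTop ℕ∞) (fun x => ev x P) := by
  induction P using MvPolynomial.induction_on with
  | C c => simpa using contDiff_const
  | add P Q hP hQ => simpa using hP.add hQ
  | mul_X P i hP =>
    simp only [map_mul, ev_X]
    exact hP.mul (by fun_prop)

theorem continuous_ev (P : Poly) : Continuous (fun x => ev x P) := (contDiff_ev P).continuous

theorem fderiv_ev (P : Poly) (x e : E3) :
    fderiv ℝ (fun x => ev x P) x e = ∑ i, e i * ev x (pderiv i P) := by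
  have hd : ∀ P : Poly, DifferentiableAt ℝ (fun x => ev x P) x :=
    fun P => (contDiff_ev P).differentiable (by simp) x
  induction P using MvPolynomial.induction_on with
  | C c => simp
  | add P Q hP hQ =>
    have : (fun x => ev x (P + Q)) = (fun x => ev x P) + fun x => ev x Q := by
      ext; simp
    rw [this, fderiv_add (hd P) (hd Q)]
    simp [hP, hQ, mul_add, Finset.sum_add_distrib]
  | mul_X P i hP =>
    have h1 : HasFDerivAt (fun x : E3 => x i) (EuclideanSpace.proj (𝕜 := ℝ) i) x :=
      (EuclideanSpace.proj (𝕜 := ℝ) i : E3 →L[ℝ] ℝ).hasFDerivAt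
    have h2 := ((hd P).hasFDerivAt.mul h1).fderiv
    have : (fun x => ev x (P * X i)) = fun x : E3 => ev x P * x i := by
      ext; simp
    rw [this]
    refine (congrArg (fun T : E3 →L[ℝ] ℝ => T e) h2).trans ?_
    simp [hP, Derivation.leibniz, mul_add, Finset.sum_add_distrib, MvPolynomial.pderiv_X,
      Pi.single_apply, apply_ite, Finset.mul_sum]
    rw [mul_comm]
    congr 1
    exact Finset.sum_congr rfl fun j _ => by ring

/-- The derivation `P ↦ (x × ∇P)_m` along the rotations about the `m`-th axis. -/
def lie (m : Fin 3) : Derivation ℝ Poly Poly :=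
  (X (m + 1) : Poly) • pderiv (m + 2) - (X (m + 2) : Poly) • pderiv (m + 1)

theorem lie_apply (m : Fin 3) (P : Poly) :
    lie m P = X (m + 1) * pderiv (m + 2) P - X (m + 2) * pderiv (m + 1) P := rfl

theorem fderiv_rotGen_eq (m : Fin 3) (F : E3 → ℝ) (x : E3) :
    fderiv ℝ F x (rotGen m x) = x (m + 1) * fderiv ℝ F x (EuclideanSpace.single (m + 2) 1)
      - x (m + 2) * fderiv ℝ F x (EuclideanSpace.single (m + 1) 1) := by
  simp [rotGen]

theorem fderiv_ev_rotGen (m : Fin 3) (P : Poly) (x : E3) :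
    fderiv ℝ (fun x => ev x P) x (rotGen m x) = ev x (lie m P) := by
  rw [fderiv_rotGen_eq, fderiv_ev, fderiv_ev]
  simp [lie_apply, PiLp.single_apply]

theorem integral_lie (a : ℝ) (m : Fin 3) (P : Poly) : ∫ x, ev x (lie m P) ∂(area a) = 0 := by
  simpa only [fderiv_ev_rotGen] using integral_fderiv_rotGen a m (contDiff_ev P)

theorem ev_smul_of_isHomogeneous {n : ℕ} {P : Poly} (hP : P.IsHomogeneous n) (c : ℝ) (x : E3) :
    ev (c • x) P = c ^ n * ev x P := by
  simp only [ev, MvPolynomial.aeval_def, MvPolynomial.eval₂_eq', Finset.mul_sum]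
  refine Finset.sum_congr rfl fun d hd => ?_
  have hn : ∑ i, d i = n := by
    have := hP (MvPolynomial.mem_support_iff.1 hd)
    simpa [Finsupp.weight_apply, Finsupp.sum_fintype] using this
  simp only [PiLp.smul_apply, smul_eq_mul, mul_pow, Finset.prod_mul_distrib]
  rw [Finset.prod_pow_eq_pow_sum, hn]
  ring

/-- A homogeneous polynomial that vanishes in `L²` of the sphere is zero. -/
theorem eq_zero_of_integral_sq_eq_zero {a : ℝ} (ha : 0 < a) {n : ℕ} {P : Poly}
    (hP : P.IsHomogeneous n) (h : ∫ x, ev x P * ev x P ∂(area a) = 0) : P = 0 := by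
  have h1 : (fun x => ev x P * ev x P) =ᵐ[area a] 0 :=
    (integral_eq_zero_iff_of_nonneg (fun x => mul_self_nonneg _)
      (integrable_area_of_continuous a ((continuous_ev P).mul (continuous_ev P)))).1 h
  have hm : Measurable (fun x : sphere (0 : E3) 1 => a • (x : E3)) := by fun_prop
  have h2 : ∀ᵐ x ∂((volume : Measure E3).toSphere.map
      (fun x : sphere (0 : E3) 1 => a • (x : E3))), ev x P * ev x P = 0 := by
    unfold area at h1
    have h0 : ENNReal.ofReal (a ^ 2) ≠ 0 := by
      rw [Ne, ENNReal.ofReal_eq_zero, not_le]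
      positivity
    exact (Measure.ae_ennreal_smul_measure_iff h0).1 h1
  have h3 : (fun x : sphere (0 : E3) 1 => ev (a • (x : E3)) P) =ᵐ[(volume : Measure E3).toSphere]
      fun _ => 0 := by
    filter_upwards [ae_of_ae_map hm.aemeasurable h2] with x hx using mul_self_eq_zero.1 hx
  -- The surface measure charges every nonempty open set, so for continuous functions equality
  -- almost everywhere is equality.
  have h4 := Measure.eq_of_ae_eq h3 ((continuous_ev P).comp (by fun_prop)) continuous_const
  have h5 : ∀ y : E3, y ≠ 0 → ev y P = 0 := by
    intro y hy
    have hn : ‖y‖ ≠ 0 := norm_ne_zero_iff.2 hy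
    let z : sphere (0 : E3) 1 := ⟨‖y‖⁻¹ • y, by simp [norm_smul, hn]⟩
    have h6 : y = (a⁻¹ * ‖y‖) • (a • (z : E3)) := by
      simp only [z, smul_smul]
      rw [show a⁻¹ * ‖y‖ * (a * ‖y‖⁻¹) = 1 by field_simp, one_smul]
    have h7 : ev (a • (z : E3)) P = 0 := congrFun h4 z
    rw [h6, ev_smul_of_isHomogeneous hP, h7, mul_zero]
  have h6 : (fun y => ev y P) = fun _ => 0 :=
    (continuous_ev P).ext_on (dense_compl_singleton (0 : E3)) continuous_const h5
  refine MvPolynomial.funext fun y => ?_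
  simpa [ev, MvPolynomial.aeval_def] using congrFun h6 (WithLp.toLp 2 y)

/-- An integrable function on the sphere that is orthogonal to all polynomials vanishes. -/
theorem ae_eq_zero_of_integral_ev_eq_zero {a : ℝ} {w : E3 → ℝ} (hw : Integrable w (area a))
    (h : ∀ P : Poly, ∫ x, w x * ev x P ∂(area a) = 0) : ∀ᵐ x ∂(area a), w x = 0 := by
  -- It suffices to test with smooth `g`; Stone-Weierstrass approximates `g` uniformly on the sphere
  -- by polynomials.
  refine ae_eq_zero_of_integral_contDiff_smul_eq_zero hw.locallyIntegrable fun g hg _ => ?_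
  let φ : Poly →ₐ[ℝ] C(E3, ℝ) := MvPolynomial.aeval fun i => ⟨fun x : E3 => x i, by fun_prop⟩
  have hφ : ∀ P x, φ P x = ev x P := by
    intro P x
    induction P using MvPolynomial.induction_on with
    | C c => simp [φ]
    | add P Q hP hQ => simp [hP, hQ]
    | mul_X P i hP => simp [hP, φ]
  have hsep : φ.range.SeparatesPoints := by
    intro x y hxy
    obtain ⟨i, hi⟩ : ∃ i, x i ≠ y i := by
      by_contra! hc
      exact hxy (PiLp.ext hc)
    exact ⟨_, ⟨φ (X i), ⟨X i, rfl⟩, rfl⟩, by simpa [hφ] using hi⟩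
  have hwn : 0 ≤ ∫ x, ‖w x‖ ∂(area a) := integral_nonneg fun x => norm_nonneg _
  refine norm_eq_zero.1 (le_antisymm (le_of_forall_pos_le_add fun ε hε => ?_) (norm_nonneg _))
  obtain ⟨_, ⟨P, rfl⟩, hP⟩ :=
    ContinuousMap.exists_mem_subalgebra_near_continuous_of_isCompact_of_separatesPoints hsep
      ⟨g, hg.continuous⟩ (isCompact_sphere (0 : E3) |a|)
      -- The summand 1 keeps the denominator positive when `w` vanishes.
      (ε := ε / (1 + ∫ x, ‖w x‖ ∂(area a))) (by positivity)
  have hi1 : Integrable (fun x => w x * ev x P) (area a) :=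
    hw.mul_of_top_left (memLp_of_continuous a ⊤ (continuous_ev P))
  have hi2 : Integrable (fun x => g x • w x) (area a) := by
    simp only [smul_eq_mul, mul_comm (g _)]
    exact hw.mul_of_top_left (memLp_of_continuous a ⊤ hg.continuous)
  have h1 : ∫ x, g x • w x ∂(area a) = ∫ x, (g x • w x - w x * ev x P) ∂(area a) := by
    rw [integral_sub hi2 hi1, h P, sub_zero]
  rw [h1, zero_add]
  calc _ ≤ ∫ x, (ε / (1 + ∫ x, ‖w x‖ ∂(area a))) * ‖w x‖ ∂(area a) := by
        refine norm_integral_le_of_norm_le (hw.norm.const_mul _) ?_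
        filter_upwards [ae_mem_sphere] with x hx
        have := (hP x hx).le
        change ‖φ P x - g x‖ ≤ _ at this
        rw [hφ] at this
        rw [smul_eq_mul, mul_comm (g x), ← mul_sub, norm_mul, mul_comm, ← norm_neg (g x - _),
          neg_sub]
        gcongr
    _ = ε * ((∫ x, ‖w x‖ ∂(area a)) / (1 + ∫ x, ‖w x‖ ∂(area a))) := by
        rw [integral_const_mul]
        ring
    _ ≤ ε * 1 := by
        gcongr
        rw [div_le_one (by positivity)]
        linarith
    _ = ε := mul_one ε

/-! ### Algebra of the rotation derivations -/

/-- The commutator of two derivations is a derivation, and this one kills the variables. -/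
theorem pderiv_comm (i j : Fin 3) (P : Poly) :
    pderiv i (pderiv j P) = pderiv j (pderiv i P) := by
  let D (k : Fin 3) : Derivation ℝ Poly Poly := pderiv k
  have h : ⁅D i, D j⁆ = 0 := by
    refine MvPolynomial.derivation_ext fun k => ?_
    simp [D, Derivation.commutator_apply, MvPolynomial.pderiv_X, Pi.single_apply, apply_ite]
  have h2 := congrArg (fun D : Derivation ℝ Poly Poly => D P) h
  simpa [D, Derivation.commutator_apply, sub_eq_zero] using h2

/-- This rule and the next two are oriented for `simp`: mixed second derivatives get the smaller
index outside, after which `ring` can compare them. -/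
theorem pderiv_one_zero (P : Poly) : pderiv 1 (pderiv 0 P) = pderiv 0 (pderiv 1 P) :=
  pderiv_comm _ _ _

theorem pderiv_two_zero (P : Poly) : pderiv 2 (pderiv 0 P) = pderiv 0 (pderiv 2 P) :=
  pderiv_comm _ _ _

theorem pderiv_two_one (P : Poly) : pderiv 2 (pderiv 1 P) = pderiv 1 (pderiv 2 P) :=
  pderiv_comm _ _ _

theorem lie_zero (P : Poly) : lie 0 P = X 1 * pderiv 2 P - X 2 * pderiv 1 P := rfl

theorem lie_one (P : Poly) : lie 1 P = X 2 * pderiv 0 P - X 0 * pderiv 2 P := rfl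

theorem lie_two (P : Poly) : lie 2 P = X 0 * pderiv 1 P - X 1 * pderiv 0 P := rfl

/-- The polynomial `|x|²`. -/
def rsq : Poly := ∑ i, X i * X i

/-- The Euclidean Laplacian. -/
def lap : Poly →ₗ[ℝ] Poly := ∑ i : Fin 3, (pderiv i).toLinearMap ∘ₗ (pderiv i).toLinearMap

/-- The Euler operator `x · ∇`. -/
def euler : Derivation ℝ Poly Poly := ∑ i : Fin 3, (X i : Poly) • pderiv i

/-- The square `∑ (x × ∇)_m²` of the rotation derivations; it is `|x|²` times the Laplace-Beltrami
operator of the spheres. -/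
def lieSq : Poly →ₗ[ℝ] Poly := ∑ m : Fin 3, (lie m).toLinearMap ∘ₗ (lie m).toLinearMap

theorem rsq_eq : rsq = X 0 * X 0 + X 1 * X 1 + X 2 * X 2 := by simp [rsq, Fin.sum_univ_three]

theorem lap_apply (P : Poly) : lap P =
    pderiv 0 (pderiv 0 P) + pderiv 1 (pderiv 1 P) + pderiv 2 (pderiv 2 P) := by
  simp [lap, Fin.sum_univ_three]

theorem euler_apply (P : Poly) :
    euler P = X 0 * pderiv 0 P + X 1 * pderiv 1 P + X 2 * pderiv 2 P := by
  simp [euler, Fin.sum_univ_three]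

theorem lieSq_apply (P : Poly) :
    lieSq P = lie 0 (lie 0 P) + lie 1 (lie 1 P) + lie 2 (lie 2 P) := by
  simp [lieSq, Fin.sum_univ_three]

/-- Lagrange's identity for |x × ∇|², with the first-order terms produced by moving derivatives past
the coordinates: the splitting of the Laplacian into radial and angular parts. -/
theorem lieSq_eq (P : Poly) : lieSq P = rsq * lap P - euler (euler P) - euler P := by
  simp [lieSq_apply, lap_apply, euler_apply, rsq_eq, lie_zero, lie_one, lie_two,
    Derivation.leibniz, MvPolynomial.pderiv_X, pderiv_one_zero, pderiv_two_zero, pderiv_two_one]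
  ring

theorem lie_rsq_mul (m : Fin 3) (P : Poly) : lie m (rsq * P) = rsq * lie m P := by
  have h : lie m rsq = 0 := by
    fin_cases m <;> simp [lie_apply, rsq_eq, Derivation.leibniz, MvPolynomial.pderiv_X] <;> ring
  simp [Derivation.leibniz, h]

theorem lieSq_rsq_mul (P : Poly) : lieSq (rsq * P) = rsq * lieSq P := by
  simp only [lieSq_apply, lie_rsq_mul]
  ring

theorem euler_of_isHomogeneous {n : ℕ} {P : Poly} (hP : P.IsHomogeneous n) :
    euler P = (n : ℝ) • P := by
  have h := hP.sum_X_mul_pderiv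
  rw [Fin.sum_univ_three] at h
  rw [euler_apply, h, Nat.cast_smul_eq_nsmul]

/-- Where |x|² is constant, `lieSq` is thus the scalar -n(n + 1) up to lower degree; the inductions
on the degree rest on this. -/
theorem lieSq_of_isHomogeneous {n : ℕ} {P : Poly} (hP : P.IsHomogeneous n) :
    lieSq P = rsq * lap P - ((n : ℝ) * (n + 1)) • P := by
  rw [lieSq_eq, euler_of_isHomogeneous hP, Derivation.map_smul, euler_of_isHomogeneous hP]
  module

theorem isHomogeneous_lie {n : ℕ} {P : Poly} (hP : P.IsHomogeneous n) (m : Fin 3) :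
    (lie m P).IsHomogeneous n := by
  -- Degree 0 is separate: there the truncated degree of `pderiv` would give each product the degree
  -- 1.
  rcases n with _ | n
  · obtain ⟨c, rfl⟩ : ∃ c, P = C c := ⟨_, MvPolynomial.totalDegree_eq_zero_iff_eq_C.1
      (Nat.le_zero.1 hP.totalDegree_le)⟩
    simpa [lie_apply] using MvPolynomial.isHomogeneous_zero (Fin 3) ℝ 0
  · have h (i j : Fin 3) : (X i * pderiv j P).IsHomogeneous (n + 1) := by
      simpa [add_comm] using (MvPolynomial.isHomogeneous_X ℝ i).mul (hP.pderiv (i := j))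
    exact (h _ _).sub (h _ _)

theorem isHomogeneous_lieSq {n : ℕ} {P : Poly} (hP : P.IsHomogeneous n) :
    (lieSq P).IsHomogeneous n := by
  rw [lieSq_apply]
  exact ((isHomogeneous_lie (isHomogeneous_lie hP _) _).add
    (isHomogeneous_lie (isHomogeneous_lie hP _) _)).add
    (isHomogeneous_lie (isHomogeneous_lie hP _) _)

theorem isHomogeneous_lap {n : ℕ} {P : Poly} (hP : P.IsHomogeneous (n + 2)) :
    (lap P).IsHomogeneous n := by
  rw [lap_apply]
  exact ((hP.pderiv.pderiv).add hP.pderiv.pderiv).add hP.pderiv.pderiv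

theorem lap_of_isHomogeneous_one {P : Poly} (hP : P.IsHomogeneous 1) : lap P = 0 := by
  have h (i : Fin 3) : pderiv i (pderiv i P) = 0 := by
    obtain ⟨c, hc⟩ : ∃ c, pderiv i P = C c := ⟨_, MvPolynomial.totalDegree_eq_zero_iff_eq_C.1
      (Nat.le_zero.1 hP.pderiv.totalDegree_le)⟩
    rw [hc, MvPolynomial.pderiv_C]
  simp [lap_apply, h]

theorem ext_of_isHomogeneous {ℓ : Poly →ₗ[ℝ] ℝ}
    (h : ∀ n (P : Poly), P.IsHomogeneous n → ℓ P = 0) (P : Poly) : ℓ P = 0 := by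
  rw [← MvPolynomial.sum_homogeneousComponent P, map_sum]
  exact Finset.sum_eq_zero fun n _ => h n _ (MvPolynomial.homogeneousComponent_isHomogeneous n P)

/-- A functional on the polynomials on the sphere that vanishes on constants and on the range of
the Laplace-Beltrami operator is zero. -/
theorem eq_zero_of_lieSq {a : ℝ} {ℓ : Poly →ₗ[ℝ] ℝ} (hr : ∀ P, ℓ (rsq * P) = a ^ 2 * ℓ P)
    (h1 : ∀ c, ℓ (C c) = 0) (h : ∀ P, ℓ (lieSq P) = 0) (P : Poly) : ℓ P = 0 := by
  refine ext_of_isHomogeneous (fun n => ?_) P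
  induction n using Nat.strong_induction_on with
  | _ n ih =>
    intro P hP
    have hn := h P
    -- What remains is n(n + 1) ℓ(P) = a² ℓ(`lap P`), whose right side has lower degree.
    rw [lieSq_of_isHomogeneous hP, map_sub, hr, map_smul, smul_eq_mul] at hn
    rcases n with _ | _ | n
    · rw [MvPolynomial.totalDegree_eq_zero_iff_eq_C.1 (Nat.le_zero.1 hP.totalDegree_le), h1]
    · rw [lap_of_isHomogeneous_one hP, map_zero, mul_zero, zero_sub, neg_eq_zero] at hn
      exact (mul_eq_zero.1 hn).resolve_left (by norm_num)
    · rw [ih n (by omega) _ (isHomogeneous_lap hP), mul_zero, zero_sub, neg_eq_zero] at hn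
      exact (mul_eq_zero.1 hn).resolve_left (by positivity)

/-- The integrand is half the rotational derivative of P². This is the skewness that makes scalar
plus `lie m` injective. -/
theorem integral_lie_mul_self (a : ℝ) (m : Fin 3) (P : Poly) :
    ∫ x, ev x (lie m P) * ev x P ∂(area a) = 0 := by
  have h := integral_lie a m (P * P)
  have h2 : ∀ x, ev x (lie m (P * P)) = 2 * (ev x (lie m P) * ev x P) := by
    intro x
    simp [Derivation.leibniz]
    ring
  simp only [h2, integral_const_mul] at h
  linarith

/-- On homogeneous polynomials, the sum of a nonzero scalar and a multiple of a rotation derivation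
is onto. -/
theorem exists_smul_add_smul_lie_eq {s : ℝ} (hs : s ≠ 0) (c : ℝ) (m : Fin 3) {n : ℕ} {P : Poly}
    (hP : P.IsHomogeneous n) : ∃ Q : Poly, Q.IsHomogeneous n ∧ s • Q + c • lie m Q = P := by
  let V := MvPolynomial.homogeneousSubmodule (Fin 3) ℝ n
  have hfin : Module.Finite ℝ V :=
    Module.Finite.iff_fg.2 (MvPolynomial.homogeneousSubmodule_fg (Fin 3) ℝ n)
  let D : Poly →ₗ[ℝ] Poly := s • LinearMap.id + c • (lie m).toLinearMap
  have hD : ∀ Q ∈ V, D Q ∈ V := fun Q hQ =>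
    V.add_mem (V.smul_mem s hQ) (V.smul_mem c (isHomogeneous_lie hQ m))
  let T : V →ₗ[ℝ] V := D.restrict hD
  have hT : ∀ Q, (T Q : Poly) = s • (Q : Poly) + c • lie m Q := fun Q => rfl
  have hinj : Function.Injective T := by
    rw [injective_iff_map_eq_zero]
    intro Q hQ
    have h0 : s • (Q : Poly) + c • lie m Q = 0 := by rw [← hT, hQ]; rfl
    -- Pairing the equation with Q removes the skew term and leaves s ∫ Q² = 0. The statement is
    -- algebraic, so the unit sphere serves as well as any other.
    refine Subtype.ext (eq_zero_of_integral_sq_eq_zero one_pos Q.2 ?_)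
    have h1 : ∀ x, ev x (Q : Poly) * ev x (Q : Poly)
        = -(c / s) * (ev x (lie m Q) * ev x (Q : Poly)) := by
      intro x
      have h2 := congrArg (ev x) h0
      simp only [map_add, map_smul, smul_eq_mul, map_zero] at h2
      field_simp
      linear_combination ev x (Q : Poly) * h2
    simp only [h1, integral_const_mul, integral_lie_mul_self, mul_zero]
  obtain ⟨Q, hQ⟩ := LinearMap.injective_iff_surjective.1 hinj ⟨P, hP⟩
  exact ⟨Q, Q.2, by rw [← hT, hQ]⟩

/-- A functional on the polynomials on the sphere that vanishes in degree at most one and on the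
range of `(L + 2) L + c ∂_m`, with `L` the Laplace-Beltrami operator of the unit sphere,
is zero. -/
theorem eq_zero_of_stokes_coriolis {a c : ℝ} {m : Fin 3} {ℓ : Poly →ₗ[ℝ] ℝ}
    (hr : ∀ P, ℓ (rsq * P) = a ^ 2 * ℓ P) (h0 : ∀ c, ℓ (C c) = 0)
    (h1 : ∀ P : Poly, P.IsHomogeneous 1 → ℓ P = 0)
    (h : ∀ P, ℓ (lieSq (lieSq P) + (2 : ℝ) • lieSq P + c • lie m P) = 0) (P : Poly) :
    ℓ P = 0 := by
  refine ext_of_isHomogeneous (fun n => ?_) P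
  induction n using Nat.strong_induction_on with
  | _ n ih =>
    intro P hP
    rcases n with _ | _ | n
    · rw [MvPolynomial.totalDegree_eq_zero_iff_eq_C.1 (Nat.le_zero.1 hP.totalDegree_le), h0]
    · exact h1 P hP
    · set N : ℝ := ((n + 2 : ℕ) : ℝ) * ((n + 2 : ℕ) + 1) with hN
      -- N(N - 2) is the leading coefficient of (L + 2)L. It vanishes in degrees 0 and 1, which are
      -- therefore assumed; from degree 2 on, N ≥ 6.
      have hs : N ^ 2 - 2 * N ≠ 0 := by
        have h6 : 6 ≤ N := by
          rw [hN]
          push_cast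
          nlinarith [(Nat.cast_nonneg n : (0 : ℝ) ≤ n)]
        nlinarith
      -- P is the leading part of the operator applied to Q; the rest is |x|² times a polynomial of
      -- degree two less, covered by induction.
      obtain ⟨Q, hQ, rfl⟩ := exists_smul_add_smul_lie_eq hs c m hP
      have hlow : lieSq (lieSq Q) + (2 : ℝ) • lieSq Q + c • lie m Q
          = ((N ^ 2 - 2 * N) • Q + c • lie m Q)
            + rsq * (lieSq (lap Q) + (2 - N) • lap Q) := by
        rw [lieSq_of_isHomogeneous hQ, ← hN, map_sub, lieSq_rsq_mul, map_smul,
          lieSq_of_isHomogeneous hQ, ← hN]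
        simp only [MvPolynomial.smul_eq_C_mul]
        simp only [map_sub, map_mul, map_pow, map_ofNat]
        ring
      have hz := h Q
      have hlap := isHomogeneous_lap hQ
      rw [hlow, map_add, hr, map_add ℓ (lieSq _), map_smul ℓ (2 - N),
        ih n (by omega) _ (isHomogeneous_lieSq hlap), ih n (by omega) _ hlap] at hz
      simpa using hz

/-! ### Rotational fields `x × ∇P` -/

theorem sum_X_mul_lie (P : Poly) : ∑ k, X k * lie k P = 0 := by
  simp [Fin.sum_univ_three, lie_zero, lie_one, lie_two]
  ring

theorem sum_pderiv_lie (P : Poly) : ∑ k, pderiv k (lie k P) = 0 := by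
  simp [Fin.sum_univ_three, lie_zero, lie_one, lie_two, Derivation.leibniz,
    MvPolynomial.pderiv_X, pderiv_one_zero, pderiv_two_zero, pderiv_two_one]

theorem euler_lie (k : Fin 3) (P : Poly) : euler (lie k P) = lie k (euler P) := by
  fin_cases k <;> simp [euler_apply, lie_zero, lie_one, lie_two, Derivation.leibniz,
    MvPolynomial.pderiv_X, pderiv_one_zero, pderiv_two_zero, pderiv_two_one] <;> ring

theorem lap_lie (k : Fin 3) (P : Poly) : lap (lie k P) = lie k (lap P) := by
  fin_cases k <;> simp [lap_apply, lie_zero, lie_one, lie_two, Derivation.leibniz,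
    MvPolynomial.pderiv_X, pderiv_one_zero, pderiv_two_zero, pderiv_two_one] <;> ring

/-- |x|², the Laplacian and the Euler operator are all invariant under rotations. -/
theorem lieSq_lie (k : Fin 3) (P : Poly) : lieSq (lie k P) = lie k (lieSq P) := by
  simp only [lieSq_eq, lap_lie, euler_lie, map_sub, lie_rsq_mul]

theorem sum_X_mul_pderiv_lie (l : Fin 3) (P : Poly) : ∑ k, X k * pderiv l (lie k P) = -lie l P := by
  have h := congrArg (pderiv l) (sum_X_mul_lie P)
  simp only [map_sum, Derivation.leibniz, smul_eq_mul, map_zero, Finset.sum_add_distrib,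
    MvPolynomial.pderiv_X, Pi.single_apply, mul_ite, mul_one, mul_zero, Finset.sum_ite_eq',
    Finset.mem_univ, if_true] at h
  linear_combination h

theorem euler_eq_sum (P : Poly) : euler P = ∑ l, X l * pderiv l P := by
  simp [euler_apply, Fin.sum_univ_three]

theorem pderiv_euler (k : Fin 3) (P : Poly) :
    pderiv k (euler P) = euler (pderiv k P) + pderiv k P := by
  fin_cases k <;> simp [euler_apply, Derivation.leibniz,
    MvPolynomial.pderiv_X, pderiv_one_zero, pderiv_two_zero, pderiv_two_one] <;> ring

/-- Twice the deformation tensor of the field `x × ∇P`, where `c = a⁻²`. -/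
def rotDeformation (c : ℝ) (P : Poly) (k l : Fin 3) : Poly :=
  pderiv l (lie k P) + pderiv k (lie l P)
    + C c * (X k * lie l (P - euler P) + lie k (P - euler P) * X l)

/-- Minus the adjoint of the tangential derivative, on tangential polynomial fields;
here `c = a⁻²`. -/
def surfaceDiv (c : ℝ) (W : Fin 3 → Poly) : Poly :=
  ∑ l, pderiv l (W l) - C c * ∑ l, X l * euler (W l)

/-- With c = a⁻² the first factor vanishes on the sphere of radius a, so there the rows of the
tensor are tangential. -/
theorem sum_mul_rotDeformation (c : ℝ) (P : Poly) (k : Fin 3) :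
    ∑ l, X l * rotDeformation c P k l = (C c * rsq - 1) * lie k (P - euler P) := by
  have h1 : ∑ l, X l * rotDeformation c P k l = euler (lie k P)
      + ∑ l, X l * pderiv k (lie l P) + C c * (X k * ∑ l, X l * lie l (P - euler P))
      + C c * (lie k (P - euler P) * rsq) := by
    simp only [rotDeformation, euler_eq_sum, rsq, Fin.sum_univ_three]
    ring
  rw [h1, sum_X_mul_pderiv_lie, sum_X_mul_lie, euler_lie, map_sub]
  ring

/-- A polynomial identity, valid off the sphere too; the last summand carries the factor that
vanishes on the sphere. -/
theorem surfaceDiv_rotDeformation (c : ℝ) (P : Poly) (k : Fin 3) :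
    surfaceDiv c (rotDeformation c P k) = lap (lie k P)
      + C c * lie k ((2 : ℝ) • P - euler P - euler (euler P))
      + C c * (1 - C c * rsq) * lie k (P - euler (euler P)) := by
  -- A partial derivative lowers the degree by one, which accounts for the correction term.
  have e (i j : Fin 3) : euler (pderiv i (lie j P))
      = pderiv i (lie j (euler P)) - pderiv i (lie j P) := by
    rw [← euler_lie, pderiv_euler]
    ring
  have h1 : ∑ l, pderiv l (rotDeformation c P k l) = lap (lie k P)
      + pderiv k (∑ l, pderiv l (lie l P)) + C c * (4 * lie k (P - euler P)
      + X k * (∑ l, pderiv l (lie l (P - euler P))) + euler (lie k (P - euler P))) := by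
    simp only [rotDeformation, lap_apply, euler_apply, Fin.sum_univ_three, map_add,
      Derivation.leibniz, smul_eq_mul, MvPolynomial.pderiv_C, MvPolynomial.pderiv_X,
      pderiv_comm k]
    fin_cases k <;> simp <;> ring
  have h2 : ∑ l, X l * euler (rotDeformation c P k l)
      = (∑ l, X l * pderiv l (lie k (euler P)) - ∑ l, X l * pderiv l (lie k P))
      + (∑ l, X l * pderiv k (lie l (euler P)) - ∑ l, X l * pderiv k (lie l P))
      + C c * (X k * (∑ l, X l * lie l (P - euler P))
        + X k * (∑ l, X l * lie l (euler (P - euler P)))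
        + rsq * (lie k (P - euler P) + lie k (euler (P - euler P)))) := by
    have eX (i : Fin 3) : euler (X i) = X i := by
      fin_cases i <;> simp [euler_apply, MvPolynomial.pderiv_X]
    have eC : euler (C c) = 0 := by simp
    simp only [rotDeformation, map_add, e, Derivation.leibniz, smul_eq_mul, eX, eC, euler_lie,
      rsq, Fin.sum_univ_three]
    ring
  rw [surfaceDiv, h1, h2]
  simp only [sum_pderiv_lie, sum_X_mul_lie, sum_X_mul_pderiv_lie, ← euler_eq_sum, euler_lie]
  simp only [map_sub, Derivation.map_smul, map_zero]
  simp only [MvPolynomial.smul_eq_C_mul, map_ofNat]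
  ring

/-- The Weitzenböck formula for twice the divergence of the deformation tensor: the summand 2 is the
curvature contribution. On linear P, where `lieSq` is -2, the right side vanishes, as it must for
Killing fields. -/
theorem ev_surfaceDiv_rotDeformation {a : ℝ} (ha : 0 < a) {x : E3} (hx : ev x rsq = a ^ 2)
    (P : Poly) (k : Fin 3) :
    ev x (surfaceDiv (a ^ 2)⁻¹ (rotDeformation (a ^ 2)⁻¹ P k))
      = (a ^ 2)⁻¹ * ev x (lie k (lieSq P + (2 : ℝ) • P)) := by
  rw [surfaceDiv_rotDeformation, map_add (lie k), ← lieSq_lie, lieSq_eq]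
  simp only [map_add, map_sub, map_mul, map_one, ev_C, hx, Derivation.map_smul, map_smul,
    smul_eq_mul, euler_lie]
  field_simp
  ring

/-! ### Integration by parts on the sphere -/

theorem inner_eq_sum (u v : E3) : ⟪u, v⟫ = ∑ i, u i * v i := by
  simp [PiLp.inner_apply, mul_comm]

theorem ev_rsq (x : E3) : ev x rsq = ‖x‖ ^ 2 := by
  simp [rsq, EuclideanSpace.norm_sq_eq, ← sq]

theorem ev_rsq_of_mem_sphere {a : ℝ} {x : E3} (hx : x ∈ sphere (0 : E3) a) :
    ev x rsq = a ^ 2 := by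
  rw [ev_rsq, mem_sphere_zero_iff_norm.1 hx]

theorem ae_mem_sphere_of_pos {a : ℝ} (ha : 0 < a) : ∀ᵐ x ∂(area a), x ∈ sphere (0 : E3) a := by
  simpa [abs_of_pos ha] using ae_mem_sphere (a := a)

theorem sum_fderiv_mul (F : E3 → ℝ) (x e : E3) :
    fderiv ℝ F x e = ∑ l, e l * fderiv ℝ F x (EuclideanSpace.single l 1) := by
  conv_lhs => rw [← (EuclideanSpace.basisFun (Fin 3) ℝ).sum_repr e]
  simp

theorem continuous_fderiv_apply {F : E3 → ℝ} (hF : ContDiff ℝ ((⊤ : ℕ∞) : WithTop ℕ∞) F)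
    {e : E3 → E3} (he : Continuous e) : Continuous fun x => fderiv ℝ F x (e x) :=
  (hF.continuous_fderiv (by simp)).clm_apply he

theorem integral_mul_fderiv_rotGen (a : ℝ) (m : Fin 3) (Z : Poly) {f : E3 → ℝ}
    (hf : ContDiff ℝ ((⊤ : ℕ∞) : WithTop ℕ∞) f) :
    ∫ x, ev x Z * fderiv ℝ f x (rotGen m x) ∂(area a) = -∫ x, f x * ev x (lie m Z) ∂(area a) := by
  have h := integral_fderiv_rotGen a m ((contDiff_ev Z).mul hf)
  have h2 : ∀ x, fderiv ℝ (fun x => ev x Z * f x) x (rotGen m x)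
      = ev x Z * fderiv ℝ f x (rotGen m x) + f x * ev x (lie m Z) := by
    intro x
    rw [fderiv_fun_mul ((contDiff_ev Z).differentiable (by simp) x)
      (hf.differentiable (by simp) x)]
    simp [fderiv_ev_rotGen]
  simp only [h2] at h
  have i1 : Integrable (fun x => ev x Z * fderiv ℝ f x (rotGen m x)) (area a) :=
    integrable_area_of_continuous a ((continuous_ev Z).mul
      (continuous_fderiv_apply hf (continuous_rotGen m)))
  have i2 : Integrable (fun x => f x * ev x (lie m Z)) (area a) :=
    integrable_area_of_continuous a (hf.continuous.mul (continuous_ev _))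
  rw [integral_add i1 i2] at h
  linarith

/-- The divergence theorem on the sphere, for a tangential polynomial field. -/
theorem integral_sum_mul_fderiv {a : ℝ} (ha : 0 < a) {W : Fin 3 → Poly}
    (hW : ∀ x ∈ sphere (0 : E3) a, ev x (∑ l, X l * W l) = 0) {f : E3 → ℝ}
    (hf : ContDiff ℝ ((⊤ : ℕ∞) : WithTop ℕ∞) f) :
    ∫ x, ∑ l, ev x (W l) * fderiv ℝ f x (EuclideanSpace.single l 1) ∂(area a)
      = -∫ x, f x * ev x (surfaceDiv (a ^ 2)⁻¹ W) ∂(area a) := by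
  -- Z = x × W. For tangential W, (x × W) · (x × ∇f) = a² W · ∇f on the sphere, so only rotational
  -- derivatives of f need to be integrated by parts.
  let Z : Fin 3 → Poly := fun m => X (m + 1) * W (m + 2) - X (m + 2) * W (m + 1)
  have hZ : ∑ m, lie m (Z m) = rsq * (∑ l, pderiv l (W l)) - 2 * (∑ l, X l * W l)
      - ∑ l, X l * euler (W l) := by
    simp [Z, Fin.sum_univ_three, lie_zero, lie_one, lie_two, rsq_eq, euler_apply,
      Derivation.leibniz, MvPolynomial.pderiv_X]
    ring
  have h1 : ∫ x, ∑ m, ev x (Z m) * fderiv ℝ f x (rotGen m x) ∂(area a)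
      = -∫ x, ∑ m, f x * ev x (lie m (Z m)) ∂(area a) := by
    have i1 (m : Fin 3) : Integrable (fun x => ev x (Z m) * fderiv ℝ f x (rotGen m x)) (area a) :=
      integrable_area_of_continuous a ((continuous_ev _).mul
        (continuous_fderiv_apply hf (continuous_rotGen m)))
    have i2 (m : Fin 3) : Integrable (fun x => f x * ev x (lie m (Z m))) (area a) :=
      integrable_area_of_continuous a (hf.continuous.mul (continuous_ev _))
    rw [integral_finsetSum _ fun m _ => i1 m, integral_finsetSum _ fun m _ => i2 m,
      ← Finset.sum_neg_distrib]
    exact Finset.sum_congr rfl fun m _ => integral_mul_fderiv_rotGen a m (Z m) hf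
  have h2 : ∫ x, ∑ m, ev x (Z m) * fderiv ℝ f x (rotGen m x) ∂(area a)
      = a ^ 2 * ∫ x, ∑ l, ev x (W l) * fderiv ℝ f x (EuclideanSpace.single l 1) ∂(area a) := by
    rw [← integral_const_mul]
    refine integral_congr_ae ?_
    filter_upwards [ae_mem_sphere_of_pos ha] with x hx
    have e1 := ev_rsq_of_mem_sphere hx
    have e2 := hW x hx
    simp only [rsq_eq, Fin.sum_univ_three, map_add, map_mul, ev_X] at e1 e2
    simp only [Z, fderiv_rotGen_eq, Fin.sum_univ_three, map_sub, map_mul, ev_X]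
    simp
    linear_combination (ev x (W 0) * fderiv ℝ f x (EuclideanSpace.single 0 1)
      + ev x (W 1) * fderiv ℝ f x (EuclideanSpace.single 1 1)
      + ev x (W 2) * fderiv ℝ f x (EuclideanSpace.single 2 1)) * e1
      - (x 0 * fderiv ℝ f x (EuclideanSpace.single 0 1)
      + x 1 * fderiv ℝ f x (EuclideanSpace.single 1 1)
      + x 2 * fderiv ℝ f x (EuclideanSpace.single 2 1)) * e2
  have h3 : ∫ x, ∑ m, f x * ev x (lie m (Z m)) ∂(area a)
      = a ^ 2 * ∫ x, f x * ev x (surfaceDiv (a ^ 2)⁻¹ W) ∂(area a) := by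
    rw [← integral_const_mul]
    refine integral_congr_ae ?_
    filter_upwards [ae_mem_sphere_of_pos ha] with x hx
    rw [← Finset.mul_sum, ← map_sum, hZ, surfaceDiv]
    simp only [map_sub, map_mul, ev_rsq_of_mem_sphere hx, hW x hx, ev_C]
    field_simp
    ring
  rw [h2, h3, ← mul_neg] at h1
  exact mul_left_cancel₀ (by positivity) h1

/-! ### The covariant derivative in coordinates -/

/-- The entries of the tangential projection. -/
def projEntry (a : ℝ) (i j : Fin 3) : Poly := (if i = j then 1 else 0) - C (a ^ 2)⁻¹ * (X i * X j)

theorem projEntry_symm (a : ℝ) (i j : Fin 3) : projEntry a i j = projEntry a j i := by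
  simp [projEntry, eq_comm, mul_comm]

theorem tangentProj_apply (a : ℝ) (x v : E3) :
    tangentProj a x v = v - (a ^ 2)⁻¹ • ⟪x, v⟫ • x := by
  simp [tangentProj]

theorem tangentProj_apply_coord (a : ℝ) (x v : E3) (i : Fin 3) :
    tangentProj a x v i = ∑ j, ev x (projEntry a i j) * v j := by
  rw [tangentProj_apply, inner_eq_sum]
  simp [projEntry, sub_mul, Finset.sum_sub_distrib, apply_ite, Finset.sum_mul, Finset.mul_sum]
  exact Finset.sum_congr rfl fun j _ => by ring

/-- The `l`-th partial derivative of the `k`-th component of a field. -/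
def partialD (U : E3 → E3) (x : E3) (k l : Fin 3) : ℝ :=
  fderiv ℝ (fun y => U y k) x (EuclideanSpace.single l 1)

theorem fderiv_coord {U : E3 → E3} (hU : ContDiff ℝ ((⊤ : ℕ∞) : WithTop ℕ∞) U) (x e : E3)
    (k : Fin 3) : fderiv ℝ U x e k = fderiv ℝ (fun y => U y k) x e := by
  have h := ((EuclideanSpace.proj (𝕜 := ℝ) k : E3 →L[ℝ] ℝ).hasFDerivAt.comp x
    (hU.differentiable (by simp) x).hasFDerivAt).fderiv
  have h2 := congrArg (fun T : E3 →L[ℝ] ℝ => T e) h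
  exact h2.symm

theorem covDeriv_coord (a : ℝ) {U : E3 → E3} (hU : ContDiff ℝ ((⊤ : ℕ∞) : WithTop ℕ∞) U) (x : E3)
    (i j : Fin 3) : covDeriv a U x (i, j) = ∑ k, ∑ l,
      ev x (projEntry a i k) * partialD U x k l * ev x (projEntry a l j) := by
  change tangentProj a x (fderiv ℝ U x (tangentProj a x (EuclideanSpace.single j 1))) i = _
  rw [tangentProj_apply_coord]
  refine Finset.sum_congr rfl fun k _ => ?_
  rw [fderiv_coord hU, sum_fderiv_mul, Finset.mul_sum]
  refine Finset.sum_congr rfl fun l _ => ?_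
  rw [tangentProj_apply_coord]
  simp [PiLp.single_apply, partialD]
  ring

/-- A polynomial tensor field. -/
def polyTensor (S : Fin 3 → Fin 3 → Poly) (x : E3) : T3 :=
  WithLp.toLp 2 fun ij => ev x (S ij.1 ij.2)

/-- The tangential part of a polynomial tensor field. -/
def tangentialPart (a : ℝ) (S : Fin 3 → Fin 3 → Poly) (k l : Fin 3) : Poly :=
  ∑ i, ∑ j, projEntry a k i * S i j * projEntry a j l

theorem inner_tensor_eq_sum (S T : T3) : ⟪S, T⟫ = ∑ i, ∑ j, S (i, j) * T (i, j) := by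
  rw [PiLp.inner_apply, Fintype.sum_prod_type]
  simp [mul_comm]

/-- The projections are symmetric, so they can be moved from the derivative of U to S. -/
theorem inner_covDeriv_polyTensor (a : ℝ) {U : E3 → E3}
    (hU : ContDiff ℝ ((⊤ : ℕ∞) : WithTop ℕ∞) U) (S : Fin 3 → Fin 3 → Poly) (x : E3) :
    ⟪covDeriv a U x, polyTensor S x⟫
      = ∑ k, ∑ l, ev x (tangentialPart a S k l) * partialD U x k l := by
  have h : ∀ k l, ev x (tangentialPart a S k l) * partialD U x k l = ∑ i, ∑ j,
      ev x (projEntry a i k) * partialD U x k l * ev x (projEntry a l j) * ev x (S i j) := by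
    intro k l
    simp only [tangentialPart, map_sum, map_mul, Finset.sum_mul]
    refine Finset.sum_congr rfl fun i _ => Finset.sum_congr rfl fun j _ => ?_
    rw [projEntry_symm a k i, projEntry_symm a j l]
    ring
  simp only [h, inner_tensor_eq_sum, covDeriv_coord a hU, Finset.sum_mul, polyTensor]
  simp only [Fin.sum_univ_three]
  ring

theorem sum_mul_projEntry {a : ℝ} (ha : 0 < a) {x : E3} (hx : x ∈ sphere (0 : E3) a) (j : Fin 3) :
    ∑ l, x l * ev x (projEntry a j l) = 0 := by
  have e1 := ev_rsq_of_mem_sphere hx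
  simp only [rsq_eq, map_add, map_mul, ev_X] at e1
  have h : ∑ l, x l * ev x (projEntry a j l)
      = x j * (1 - (a ^ 2)⁻¹ * (x 0 * x 0 + x 1 * x 1 + x 2 * x 2)) := by
    simp only [projEntry, Fin.sum_univ_three]
    fin_cases j <;> simp <;> ring
  rw [h, e1]
  field_simp
  ring

theorem sum_mul_tangentialPart {a : ℝ} (ha : 0 < a) (S : Fin 3 → Fin 3 → Poly) (k : Fin 3)
    (x : E3) (hx : x ∈ sphere (0 : E3) a) : ev x (∑ l, X l * tangentialPart a S k l) = 0 := by
  have h : ev x (∑ l, X l * tangentialPart a S k l) = ∑ i, ∑ j, ev x (projEntry a k i) *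
      ev x (S i j) * ∑ l, x l * ev x (projEntry a j l) := by
    simp only [tangentialPart, map_sum, map_mul, ev_X]
    simp only [Fin.sum_univ_three]
    ring
  simp [h, sum_mul_projEntry ha hx]

/-- Integration by parts for tensor fields whose rows are tangential. -/
theorem integral_sum_partialD {a : ℝ} (ha : 0 < a) {S : Fin 3 → Fin 3 → Poly}
    (hS : ∀ k, ∀ x ∈ sphere (0 : E3) a, ev x (∑ l, X l * S k l) = 0) {U : E3 → E3}
    (hU : ContDiff ℝ ((⊤ : ℕ∞) : WithTop ℕ∞) U) :
    ∫ x, ∑ k, ∑ l, ev x (S k l) * partialD U x k l ∂(area a)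
      = -∫ x, ∑ k, U x k * ev x (surfaceDiv (a ^ 2)⁻¹ (S k)) ∂(area a) := by
  have hUk : ∀ k, ContDiff ℝ ((⊤ : ℕ∞) : WithTop ℕ∞) (fun y => U y k) := fun k => by fun_prop
  have i1 (k : Fin 3) : Integrable (fun x => ∑ l, ev x (S k l) * partialD U x k l) (area a) :=
    integrable_area_of_continuous a (continuous_finsetSum _ fun l _ => (continuous_ev _).mul
      (continuous_fderiv_apply (hUk k) continuous_const))
  have i2 (k : Fin 3) :
      Integrable (fun x => U x k * ev x (surfaceDiv (a ^ 2)⁻¹ (S k))) (area a) :=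
    integrable_area_of_continuous a ((hUk k).continuous.mul (continuous_ev _))
  rw [integral_finsetSum _ fun k _ => i1 k, integral_finsetSum _ fun k _ => i2 k,
    ← Finset.sum_neg_distrib]
  exact Finset.sum_congr rfl fun k _ => integral_sum_mul_fderiv ha (hS k) (hUk k)

/-- A polynomial vector field. -/
def polyField (W : Fin 3 → Poly) (x : E3) : E3 := WithLp.toLp 2 fun k => ev x (W k)

theorem inner_polyField (u : E3) (W : Fin 3 → Poly) (x : E3) :
    ⟪u, polyField W x⟫ = ∑ k, u k * ev x (W k) := inner_eq_sum _ _

theorem contDiff_polyField (W : Fin 3 → Poly) :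
    ContDiff ℝ ((⊤ : ℕ∞) : WithTop ℕ∞) (polyField W) := by
  rw [contDiff_euclidean]
  exact fun k => contDiff_ev (W k)

theorem continuous_polyTensor (S : Fin 3 → Fin 3 → Poly) : Continuous (polyTensor S) :=
  (PiLp.continuous_toLp 2 _).comp (continuous_pi fun ij => continuous_ev (S ij.1 ij.2))

/-- The covariant derivative is closable: against a polynomial tensor field it is given by pairing
the field itself with a polynomial field. -/
theorem integral_covDeriv_polyTensor {a : ℝ} (ha : 0 < a) (S : Fin 3 → Fin 3 → Poly) {U : E3 → E3}
    (hU : ContDiff ℝ ((⊤ : ℕ∞) : WithTop ℕ∞) U) :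
    ∫ x, ⟪covDeriv a U x, polyTensor S x⟫ ∂(area a)
      = ∫ x, ⟪U x, polyField (fun k => -surfaceDiv (a ^ 2)⁻¹ (tangentialPart a S k)) x⟫
        ∂(area a) := by
  simp only [inner_covDeriv_polyTensor a hU, inner_polyField, map_neg, mul_neg,
    Finset.sum_neg_distrib, integral_neg]
  exact integral_sum_partialD ha (sum_mul_tangentialPart ha S) hU

theorem partialD_polyField (W : Fin 3 → Poly) (x : E3) (k l : Fin 3) :
    partialD (polyField W) x k l = ev x (pderiv l (W k)) := by
  refine (fderiv_ev (W k) x _).trans ?_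
  simp [PiLp.single_apply]

/-- The rotational field `x × ∇P`. -/
def rotField (P : Poly) : E3 → E3 := polyField fun k => lie k P

theorem inner_rotField_self (P : Poly) (x : E3) : ⟪x, rotField P x⟫ = 0 := by
  have h := congrArg (ev x) (sum_X_mul_lie P)
  simpa [rotField, inner_polyField] using h

theorem isSmoothField_rotField (a : ℝ) (P : Poly) : IsSmoothField a (rotField P) :=
  ⟨contDiff_polyField _, fun x _ => inner_rotField_self P x⟩

theorem symPart_apply (S : T3) (k l : Fin 3) : symPart S (k, l) = (S (k, l) + S (l, k)) / 2 := rfl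

/-- This holds at every x, since the doubly normal term of the projected derivative contracts to x ·
(x × ∇P) = 0. -/
theorem symPart_covDeriv_rotField (a : ℝ) (P : Poly) {x : E3} (k l : Fin 3) :
    symPart (covDeriv a (rotField P) x) (k, l)
      = 2⁻¹ * ev x (rotDeformation (a ^ 2)⁻¹ P k l) := by
  have h1 : ∀ k l, covDeriv a (rotField P) x (k, l) = ev x (pderiv l (lie k P))
      + (a ^ 2)⁻¹ * (x k * ev x (lie l P)) - (a ^ 2)⁻¹ * (ev x (lie k (euler P)) * x l) := by
    intro k l
    have e1 := fun l => congrArg (ev x) (sum_X_mul_pderiv_lie l P)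
    have e2 := fun k => congrArg (ev x) ((euler_eq_sum (lie k P)).symm.trans (euler_lie k P))
    have e3 := congrArg (ev x) (sum_X_mul_lie P)
    simp only [map_sum, map_mul, ev_X, map_neg, map_zero] at e1 e2 e3
    have h2 : covDeriv a (rotField P) x (k, l) = ev x (pderiv l (lie k P))
      - (a ^ 2)⁻¹ * (x k * ∑ i, x i * ev x (pderiv l (lie i P)))
      - (a ^ 2)⁻¹ * ((∑ j, x j * ev x (pderiv j (lie k P))) * x l)
      + ((a ^ 2)⁻¹) ^ 2 * (x k * x l * ∑ j, x j * ∑ i, x i * ev x (pderiv j (lie i P))) := by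
      rw [rotField, covDeriv_coord a (contDiff_polyField _)]
      simp only [partialD_polyField, projEntry, map_sub, map_mul, ev_C, ev_X, Fin.sum_univ_three]
      fin_cases k <;> fin_cases l <;> simp <;> ring
    rw [h2, e1, e2]
    simp only [e1, mul_neg, Finset.sum_neg_distrib, e3]
    ring
  rw [symPart_apply, h1, h1]
  simp only [rotDeformation, map_add, map_mul, map_sub, ev_C, ev_X]
  ring

/-! ### Pairing with polynomial fields -/

theorem continuous_polyField (W : Fin 3 → Poly) : Continuous (polyField W) :=
  (contDiff_polyField W).continuous

theorem integrable_coord_mul_ev {a : ℝ} {u : E3 → E3} (hu : Integrable u (area a)) (k : Fin 3)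
    (P : Poly) : Integrable (fun x => u x k * ev x P) (area a) :=
  ((EuclideanSpace.proj (𝕜 := ℝ) k : E3 →L[ℝ] ℝ).integrable_comp hu).mul_of_top_left
    (memLp_of_continuous a ⊤ (continuous_ev P))

theorem integrable_inner_polyField {a : ℝ} {u : E3 → E3} (hu : Integrable u (area a))
    (W : Fin 3 → Poly) : Integrable (fun x => ⟪u x, polyField W x⟫) (area a) := by
  simp only [inner_polyField]
  exact integrable_finsetSum _ fun k _ => integrable_coord_mul_ev hu k (W k)

/-- The functional `W ↦ (u | W)` on polynomial fields. -/
def fieldFunctional {a : ℝ} {u : E3 → E3} (hu : Integrable u (area a)) :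
    (Fin 3 → Poly) →ₗ[ℝ] ℝ where
  toFun W := ∫ x, ⟪u x, polyField W x⟫ ∂(area a)
  map_add' V W := by
    rw [← integral_add (integrable_inner_polyField hu V) (integrable_inner_polyField hu W)]
    refine integral_congr_ae (Filter.Eventually.of_forall fun x => ?_)
    simp [inner_polyField, mul_add, Finset.sum_add_distrib]
  map_smul' c W := by
    rw [RingHom.id_apply, smul_eq_mul, ← integral_const_mul]
    refine integral_congr_ae (Filter.Eventually.of_forall fun x => ?_)
    simp only [inner_polyField, Pi.smul_apply, map_smul, smul_eq_mul, Finset.mul_sum]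
    exact Finset.sum_congr rfl fun k _ => by ring

theorem fieldFunctional_apply {a : ℝ} {u : E3 → E3} (hu : Integrable u (area a))
    (W : Fin 3 → Poly) : fieldFunctional hu W = ∫ x, ⟪u x, polyField W x⟫ ∂(area a) := rfl

/-- The map `P ↦ ∇P`. -/
def polyGrad : Poly →ₗ[ℝ] (Fin 3 → Poly) := LinearMap.pi fun k => (pderiv k).toLinearMap

/-- The map `P ↦ x × ∇P`. -/
def polyRot : Poly →ₗ[ℝ] (Fin 3 → Poly) := LinearMap.pi fun k => (lie k).toLinearMap

theorem polyGrad_apply (P : Poly) (k : Fin 3) : polyGrad P k = pderiv k P := rfl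

theorem polyRot_apply (P : Poly) (k : Fin 3) : polyRot P k = lie k P := rfl

theorem rotField_eq (P : Poly) : rotField P = polyField (polyRot P) := rfl

/-- Integrable tangential divergence-free fields. -/
structure IsSolenoidal (a : ℝ) (u : E3 → E3) : Prop where
  integrable : Integrable u (area a)
  tangent : ∀ᵐ x ∂(area a), ⟪x, u x⟫ = 0
  divFree : ∀ P : Poly, fieldFunctional integrable (polyGrad P) = 0

/-- By the triple product, (x × ∇Q) · ∇f = -∇Q · (x × ∇f). Integration by parts then leaves (x × ∇)
· ∇Q, which is zero by symmetry of second derivatives. -/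
theorem integral_fderiv_rotField (a : ℝ) (Q : Poly) {f : E3 → ℝ}
    (hf : ContDiff ℝ ((⊤ : ℕ∞) : WithTop ℕ∞) f) :
    ∫ x, fderiv ℝ f x (rotField Q x) ∂(area a) = 0 := by
  have h1 : ∀ x, fderiv ℝ f x (rotField Q x)
      = ∑ m, (-(ev x (pderiv m Q) * fderiv ℝ f x (rotGen m x))) := by
    intro x
    rw [sum_fderiv_mul]
    simp only [fderiv_rotGen_eq, rotField, polyField, Fin.sum_univ_three, lie_zero, lie_one,
      lie_two, map_sub, map_mul, ev_X]
    simp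
    ring
  have i1 (m : Fin 3) : Integrable
      (fun x => -(ev x (pderiv m Q) * fderiv ℝ f x (rotGen m x))) (area a) :=
    (integrable_area_of_continuous a ((continuous_ev _).mul
      (continuous_fderiv_apply hf (continuous_rotGen m)))).neg
  have i2 (m : Fin 3) : Integrable (fun x => f x * ev x (lie m (pderiv m Q))) (area a) :=
    integrable_area_of_continuous a (hf.continuous.mul (continuous_ev _))
  simp only [h1]
  rw [integral_finsetSum _ fun m _ => i1 m]
  simp only [integral_neg, integral_mul_fderiv_rotGen a _ _ hf, neg_neg]
  rw [← integral_finsetSum _ fun m _ => i2 m]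
  have h2 : ∑ m, lie m (pderiv m Q) = 0 := by
    simp [Fin.sum_univ_three, lie_zero, lie_one, lie_two, pderiv_one_zero, pderiv_two_zero,
      pderiv_two_one]
  simp only [← Finset.mul_sum, ← map_sum, h2, map_zero, mul_zero, integral_zero]

theorem isSolenoidal_rotField (a : ℝ) (Q : Poly) : IsSolenoidal a (rotField Q) where
  integrable := memLp_one_iff_integrable.1 (memLp_of_continuous a 1 (continuous_polyField _))
  tangent := Filter.Eventually.of_forall fun x => inner_rotField_self Q x
  divFree P := by
    rw [fieldFunctional_apply, ← integral_fderiv_rotField a Q (contDiff_ev P)]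
    refine integral_congr_ae (Filter.Eventually.of_forall fun x => ?_)
    simp only [inner_polyField, fderiv_ev]
    rfl

theorem fieldFunctional_sub {a : ℝ} {u v : E3 → E3} (hu : Integrable u (area a))
    (hv : Integrable v (area a)) (W : Fin 3 → Poly) :
    fieldFunctional (hu.sub hv) W = fieldFunctional hu W - fieldFunctional hv W := by
  simp only [fieldFunctional_apply, Pi.sub_apply, inner_sub_left]
  exact integral_sub (integrable_inner_polyField hu W) (integrable_inner_polyField hv W)

theorem IsSolenoidal.sub {a : ℝ} {u v : E3 → E3} (hu : IsSolenoidal a u)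
    (hv : IsSolenoidal a v) : IsSolenoidal a (u - v) where
  integrable := hu.integrable.sub hv.integrable
  tangent := by
    filter_upwards [hu.tangent, hv.tangent] with x h1 h2
    rw [Pi.sub_apply, inner_sub_right, h1, h2, sub_zero]
  divFree P := by
    rw [fieldFunctional_sub hu.integrable hv.integrable, hu.divFree, hv.divFree, sub_zero]

theorem fieldFunctional_X_mul {a : ℝ} {u : E3 → E3} (hu : IsSolenoidal a u) (R : Poly) :
    fieldFunctional hu.integrable (fun k => X k * R) = 0 := by
  rw [fieldFunctional_apply]
  refine integral_eq_zero_of_ae ?_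
  filter_upwards [hu.tangent] with x hx
  rw [inner_eq_sum] at hx
  have : ∀ k, u x k * ev x (X k * R) = ev x R * (x k * u x k) := fun k => by
    rw [map_mul, ev_X]
    ring
  simp only [inner_polyField, this, ← Finset.mul_sum, hx, mul_zero, Pi.zero_apply]

/-- An explicit splitting into a gradient, a rotational field and a multiple of x. A tangential
divergence-free field pairs only with the middle term. -/
theorem single_lieSq (i : Fin 3) (P : Poly) : (Pi.single i (lieSq P) : Fin 3 → Poly)
    = polyGrad (rsq * pderiv i P - X i * euler P) + polyRot (lie i P)
      + fun k => X k * (X i * lap P - euler (pderiv i P) - 2 * pderiv i P) := by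
  funext k
  simp only [Pi.add_apply, polyGrad_apply, polyRot_apply]
  fin_cases i <;> fin_cases k <;>
    simp [lieSq_apply, lap_apply, euler_apply, rsq_eq, lie_zero, lie_one, lie_two,
    Derivation.leibniz, MvPolynomial.pderiv_X, pderiv_one_zero, pderiv_two_zero, pderiv_two_one] <;>
    ring

/-- For divergence-free fields, `∫ u_i ΔP` only depends on the rotational functional. -/
theorem fieldFunctional_single_lieSq {a : ℝ} {u : E3 → E3} (hu : IsSolenoidal a u) (i : Fin 3)
    (P : Poly) : fieldFunctional hu.integrable (Pi.single i (lieSq P))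
      = fieldFunctional hu.integrable (polyRot (lie i P)) := by
  rw [single_lieSq, map_add, map_add, hu.divFree, fieldFunctional_X_mul hu, zero_add, add_zero]

theorem fieldFunctional_rsq_mul {a : ℝ} (ha : 0 < a) {u : E3 → E3} (hu : Integrable u (area a))
    (W : Fin 3 → Poly) : fieldFunctional hu (fun k => rsq * W k) = a ^ 2 * fieldFunctional hu W := by
  simp only [fieldFunctional_apply]
  rw [← integral_const_mul]
  refine integral_congr_ae ?_
  filter_upwards [ae_mem_sphere_of_pos ha] with x hx
  simp only [inner_polyField, map_mul, ev_rsq_of_mem_sphere hx, Finset.mul_sum]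
  exact Finset.sum_congr rfl fun k _ => by ring

theorem fieldFunctional_polyRot_rsq_mul {a : ℝ} (ha : 0 < a) {u : E3 → E3}
    (hu : Integrable u (area a)) (P : Poly) :
    fieldFunctional hu (polyRot (rsq * P)) = a ^ 2 * fieldFunctional hu (polyRot P) := by
  rw [← fieldFunctional_rsq_mul ha]
  congr 1
  funext k
  exact lie_rsq_mul k P

/-- A divergence-free field whose rotational functional vanishes is zero. -/
theorem IsSolenoidal.ae_eq_zero {a : ℝ} (ha : 0 < a) {u : E3 → E3} (hu : IsSolenoidal a u)
    (h : ∀ P, fieldFunctional hu.integrable (polyRot P) = 0) : u =ᵐ[area a] 0 := by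
  have key : ∀ i, ∀ᵐ x ∂(area a), u x i = 0 := by
    intro i
    refine ae_eq_zero_of_integral_ev_eq_zero
      ((EuclideanSpace.proj (𝕜 := ℝ) i : E3 →L[ℝ] ℝ).integrable_comp hu.integrable) fun P => ?_
    have h1 := eq_zero_of_lieSq (a := a)
      (ℓ := fieldFunctional hu.integrable ∘ₗ LinearMap.single ℝ (fun _ => Poly) i) ?_ ?_ ?_ P
    · rw [← h1]
      refine integral_congr_ae (Filter.Eventually.of_forall fun x => ?_)
      simp [inner_polyField, Pi.single_apply, apply_ite]
    · intro P
      simp only [LinearMap.comp_apply, LinearMap.single_apply]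
      rw [← fieldFunctional_rsq_mul ha]
      congr 1
      funext k
      simp [Pi.single_apply]
    · intro c
      -- A constant field is the gradient of a linear function.
      rw [← hu.divFree (C c * X i)]
      simp only [LinearMap.comp_apply, LinearMap.single_apply]
      congr 1
      funext k
      simp [polyGrad_apply, Pi.single_apply, MvPolynomial.pderiv_X, Derivation.leibniz, eq_comm]
    · intro P
      simp only [LinearMap.comp_apply, LinearMap.single_apply]
      rw [fieldFunctional_single_lieSq hu, h]
  filter_upwards [ae_all_iff.2 key] with x hx
  exact PiLp.ext hx

/-! ### Integrals of polynomials and the degree-one part of a field -/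

theorem integrable_ev (a : ℝ) (P : Poly) : Integrable (fun x => ev x P) (area a) :=
  integrable_area_of_continuous a (continuous_ev P)

/-- The integral of a polynomial over the sphere. -/
def sphereIntegral (a : ℝ) : Poly →ₗ[ℝ] ℝ where
  toFun P := ∫ x, ev x P ∂(area a)
  map_add' P Q := by
    simp only [map_add]
    exact integral_add (integrable_ev a P) (integrable_ev a Q)
  map_smul' c P := by
    simp only [map_smul, RingHom.id_apply]
    exact integral_smul c _

theorem sphereIntegral_apply (a : ℝ) (P : Poly) :
    sphereIntegral a P = ∫ x, ev x P ∂(area a) := rfl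

theorem sphereIntegral_mul_lie (a : ℝ) (m : Fin 3) (P Q : Poly) :
    sphereIntegral a (P * lie m Q) = -sphereIntegral a (lie m P * Q) := by
  have h : sphereIntegral a (lie m (P * Q)) = 0 := integral_lie a m (P * Q)
  rw [Derivation.leibniz, smul_eq_mul, smul_eq_mul, map_add, mul_comm Q] at h
  linarith

theorem sphereIntegral_mul_lieSq (a : ℝ) (P Q : Poly) :
    sphereIntegral a (P * lieSq Q) = sphereIntegral a (lieSq P * Q) := by
  simp only [lieSq_apply, mul_add, add_mul, map_add, sphereIntegral_mul_lie, neg_neg]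

theorem lieSq_of_isHomogeneous_one {Q : Poly} (hQ : Q.IsHomogeneous 1) :
    lieSq Q = -((2 : ℝ) • Q) := by
  rw [lieSq_of_isHomogeneous hQ, lap_of_isHomogeneous_one hQ]
  norm_num

/-- The rotational functional of a rotation field. -/
theorem fieldFunctional_rotField {a : ℝ} {Q : Poly} (hQ : Q.IsHomogeneous 1)
    (h : Integrable (rotField Q) (area a)) (P : Poly) :
    fieldFunctional h (polyRot P) = 2 * sphereIntegral a (Q * P) := by
  have h1 : fieldFunctional h (polyRot P) = sphereIntegral a (∑ m, lie m Q * lie m P) := by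
    refine integral_congr_ae (Filter.Eventually.of_forall fun x => ?_)
    simp only [inner_polyField, map_mul, map_sum, polyRot_apply]
    rfl
  have h2 : ∑ m, lie m (lie m Q) * P = -((2 : ℝ) • (Q * P)) := by
    have := lieSq_of_isHomogeneous_one hQ
    rw [lieSq_apply] at this
    rw [Fin.sum_univ_three, ← smul_mul_assoc]
    linear_combination P * this
  rw [h1, map_sum]
  simp only [sphereIntegral_mul_lie]
  rw [Finset.sum_neg_distrib, ← map_sum, h2, map_neg, map_smul, neg_neg, smul_eq_mul]

theorem sphereIntegral_X_mul_X_of_ne (a : ℝ) {i j : Fin 3} (hij : i ≠ j) :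
    sphereIntegral a (X i * X j) = 0 := by
  -- The product is the derivative of `X m * X (m + 2)` along the rotation about the m-th axis.
  have h (m : Fin 3) : sphereIntegral a (X m * X (m + 1)) = 0 := by
    refine (congrArg (sphereIntegral a) ?_).trans (integral_lie a m (X m * X (m + 2)))
    fin_cases m <;> simp [lie_apply, Derivation.leibniz, MvPolynomial.pderiv_X]
  obtain rfl | rfl : j = i + 1 ∨ i = j + 1 := by omega
  · exact h i
  · rw [mul_comm]
    exact h j

theorem sphereIntegral_X_mul_X_self_ne_zero {a : ℝ} (ha : 0 < a) (i : Fin 3) :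
    sphereIntegral a (X i * X i) ≠ 0 := by
  intro h
  have := eq_zero_of_integral_sq_eq_zero ha (MvPolynomial.isHomogeneous_X ℝ i)
    (by simpa only [sphereIntegral_apply, map_mul] using h)
  exact MvPolynomial.X_ne_zero i this

/-- The linear polynomial whose rotation field has the same rotational functional as `u` in
degree one. -/
def linearPart {a : ℝ} {u : E3 → E3} (hu : Integrable u (area a)) : Poly :=
  ∑ i, (fieldFunctional hu (polyRot (X i)) / (2 * sphereIntegral a (X i * X i))) • X i

theorem isHomogeneous_linearPart {a : ℝ} {u : E3 → E3} (hu : Integrable u (area a)) :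
    (linearPart hu).IsHomogeneous 1 :=
  MvPolynomial.IsHomogeneous.sum _ _ _ fun i _ =>
    (MvPolynomial.homogeneousSubmodule (Fin 3) ℝ 1).smul_mem _ (MvPolynomial.isHomogeneous_X ℝ i)

theorem exists_eq_sum_smul_X {P : Poly} (hP : P.IsHomogeneous 1) :
    ∃ c : Fin 3 → ℝ, P = ∑ j, c j • X j := by
  have hc (j : Fin 3) : ∃ c : ℝ, pderiv j P = C c := ⟨_, MvPolynomial.totalDegree_eq_zero_iff_eq_C.1
      (Nat.le_zero.1 (hP.pderiv (i := j)).totalDegree_le)⟩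
  choose c hc using hc
  refine ⟨c, ?_⟩
  have := hP.sum_X_mul_pderiv
  rw [one_smul] at this
  rw [← this]
  exact Finset.sum_congr rfl fun j _ => by rw [hc, MvPolynomial.smul_eq_C_mul, mul_comm]

/-- The coordinates are orthogonal on the sphere, so the coefficients can be read off one by one. -/
theorem sphereIntegral_linearPart_mul {a : ℝ} (ha : 0 < a) {u : E3 → E3}
    (hu : Integrable u (area a)) {P : Poly} (hP : P.IsHomogeneous 1) :
    2 * sphereIntegral a (linearPart hu * P) = fieldFunctional hu (polyRot P) := by
  have hX (j : Fin 3) : 2 * sphereIntegral a (linearPart hu * X j)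
      = fieldFunctional hu (polyRot (X j)) := by
    simp only [linearPart, Finset.sum_mul, map_sum, smul_mul_assoc, map_smul]
    rw [Finset.sum_eq_single j (fun i _ hi => by
      rw [sphereIntegral_X_mul_X_of_ne a hi, smul_zero]) (by simp)]
    have := sphereIntegral_X_mul_X_self_ne_zero ha j
    rw [smul_eq_mul]
    field_simp
  obtain ⟨c, rfl⟩ := exists_eq_sum_smul_X hP
  simp only [Finset.mul_sum, map_sum, mul_smul_comm, map_smul, ← hX, smul_eq_mul]
  exact Finset.sum_congr rfl fun j _ => by ring

/-- A divergence-free field that solves the homogeneous Stokes-Coriolis equation is a rotation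
field. -/
theorem IsSolenoidal.ae_eq_rotField {a c : ℝ} (ha : 0 < a) {u : E3 → E3} (hu : IsSolenoidal a u)
    (h : ∀ P, fieldFunctional hu.integrable
      (polyRot (lieSq (lieSq P) + (2 : ℝ) • lieSq P + c • lie 2 P)) = 0)
    (hc : c • lie 2 (linearPart hu.integrable) = 0) :
    u =ᵐ[area a] rotField (linearPart hu.integrable) := by
  set Q := linearPart hu.integrable with hQ
  have hQ1 : Q.IsHomogeneous 1 := isHomogeneous_linearPart hu.integrable
  have hQs := isSolenoidal_rotField a Q
  have hw := hu.sub hQs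
  have hwz : u - rotField Q =ᵐ[area a] 0 := by
    -- The difference has zero rotational functional in degree one. It still solves the equation:
    -- moved onto Q by parts, (L + 2)L gives 0 in degree one and `hc` removes the last term.
    refine hw.ae_eq_zero ha fun P => ?_
    refine eq_zero_of_stokes_coriolis (a := a) (c := c) (m := 2)
      (ℓ := fieldFunctional hw.integrable ∘ₗ polyRot)
      (fun P => fieldFunctional_polyRot_rsq_mul ha hw.integrable P) (fun c => ?_) (fun P hP => ?_)
      (fun P => ?_) P
    · have : polyRot (C c) = 0 := by
        funext k
        simp [polyRot_apply]
      simp [this]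
    · rw [LinearMap.comp_apply, fieldFunctional_sub hu.integrable hQs.integrable,
        fieldFunctional_rotField hQ1, sphereIntegral_linearPart_mul ha _ hP, sub_self]
    · rw [LinearMap.comp_apply, fieldFunctional_sub hu.integrable hQs.integrable, h P,
        fieldFunctional_rotField hQ1]
      have h3 : c * sphereIntegral a (lie 2 Q * P) = 0 := by
        rw [← smul_eq_mul, ← map_smul, ← smul_mul_assoc, hc, zero_mul, map_zero]
      simp only [mul_add, mul_smul_comm, map_add, map_smul, sphereIntegral_mul_lie,
        sphereIntegral_mul_lieSq, lieSq_of_isHomogeneous_one hQ1, neg_mul, smul_mul_assoc, map_neg,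
        smul_eq_mul]
      linear_combination 2 * h3
  filter_upwards [hwz] with x hx
  exact sub_eq_zero.1 hx

/-! ### Duality pairings with continuous fields -/

section Pairing

variable {a : ℝ} {q q' : ℝ≥0∞} [Fact (1 ≤ q)] [Fact (1 ≤ q')] [q.HolderConjugate q']

theorem fieldPairing_eq_integral (u : Lp E3 q (area a)) (v : Lp E3 q' (area a)) :
    fieldPairing a q q' u v = ∫ x, ⟪u x, v x⟫ ∂(area a) :=
  (innerSL ℝ).lpPairing_eq_integral u v

theorem tensorPairing_eq_integral (S : Lp T3 q (area a)) (T : Lp T3 q' (area a)) :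
    tensorPairing a q q' S T = ∫ x, ⟪S x, T x⟫ ∂(area a) :=
  (innerSL ℝ).lpPairing_eq_integral S T

theorem fieldPairing_comm (u : Lp E3 q (area a)) (v : Lp E3 q' (area a)) :
    fieldPairing a q q' u v = fieldPairing a q' q v u := by
  simp only [fieldPairing_eq_integral]
  congr 1
  funext x
  exact real_inner_comm _ _

theorem fieldPairing_congr {u : Lp E3 q (area a)} {v : Lp E3 q' (area a)} {U V : E3 → E3}
    (hu : u =ᵐ[area a] U) (hv : v =ᵐ[area a] V) :
    fieldPairing a q q' u v = ∫ x, ⟪U x, V x⟫ ∂(area a) := by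
  rw [fieldPairing_eq_integral]
  refine integral_congr_ae ?_
  filter_upwards [hu, hv] with x h1 h2
  rw [h1, h2]

theorem tensorPairing_congr {u : Lp T3 q (area a)} {v : Lp T3 q' (area a)} {U V : E3 → T3}
    (hu : u =ᵐ[area a] U) (hv : v =ᵐ[area a] V) :
    tensorPairing a q q' u v = ∫ x, ⟪U x, V x⟫ ∂(area a) := by
  rw [tensorPairing_eq_integral]
  refine integral_congr_ae ?_
  filter_upwards [hu, hv] with x h1 h2
  rw [h1, h2]

end Pairing

/-- The class of a continuous function in `L_q` of the sphere. -/
def contLp {F : Type*} [NormedAddCommGroup F] [SecondCountableTopologyEither E3 F] (a : ℝ)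
    (q : ℝ≥0∞) {f : E3 → F} (hf : Continuous f) : Lp F q (area a) :=
  (memLp_of_continuous a q hf).toLp f

theorem coeFn_contLp {F : Type*} [NormedAddCommGroup F] [SecondCountableTopologyEither E3 F]
    (a : ℝ) (q : ℝ≥0∞) {f : E3 → F} (hf : Continuous f) : contLp a q hf =ᵐ[area a] f :=
  MemLp.coeFn_toLp _

theorem integrable_coeFn {F : Type*} [NormedAddCommGroup F] {a : ℝ} {q : ℝ≥0∞} [hq : Fact (1 ≤ q)]
    (u : Lp F q (area a)) : Integrable u (area a) :=
  (Lp.memLp u).integrable hq.out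

/-! ### Smooth elements of the Sobolev spaces -/

/-- The field `x × ∇P` with its covariant derivative. -/
def rotPair (a : ℝ) (q : ℝ≥0∞) (P : Poly) : Lp E3 q (area a) × Lp T3 q (area a) :=
  (contLp a q (contDiff_polyField fun k => lie k P).continuous,
    contLp a q (continuous_covDeriv a (contDiff_polyField fun k => lie k P)))

theorem coeFn_rotPair_fst (a : ℝ) (q : ℝ≥0∞) (P : Poly) :
    (rotPair a q P).1 =ᵐ[area a] rotField P :=
  coeFn_contLp a q (contDiff_polyField fun k => lie k P).continuous

theorem coeFn_rotPair_snd (a : ℝ) (q : ℝ≥0∞) (P : Poly) :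
    (rotPair a q P).2 =ᵐ[area a] covDeriv a (rotField P) :=
  coeFn_contLp a q (continuous_covDeriv a (contDiff_polyField fun k => lie k P))

theorem continuous_surfaceGrad (a : ℝ) {Φ : E3 → ℝ} (hΦ : ContDiff ℝ ((⊤ : ℕ∞) : WithTop ℕ∞) Φ) :
    Continuous (surfaceGrad a Φ) :=
  (continuous_tangentProj a).clm_apply
    ((InnerProductSpace.toDual ℝ E3).symm.continuous.comp (hΦ.continuous_fderiv (by simp)))

/-- A polynomial with its surface gradient. -/
def scalarPair (a : ℝ) (q : ℝ≥0∞) (P : Poly) : Lp ℝ q (area a) × Lp E3 q (area a) :=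
  (contLp a q (continuous_ev P), contLp a q (continuous_surfaceGrad a (contDiff_ev P)))

theorem coeFn_scalarPair_snd (a : ℝ) (q : ℝ≥0∞) (P : Poly) :
    (scalarPair a q P).2 =ᵐ[area a] surfaceGrad a fun x => ev x P :=
  coeFn_contLp a q (continuous_surfaceGrad a (contDiff_ev P))

theorem rotPair_mem_H1 (a : ℝ) (q : ℝ≥0∞) [Fact (1 ≤ q)] (P : Poly) : rotPair a q P ∈ H1 a q :=
  Submodule.le_topologicalClosure _ ⟨rotField P, isSmoothField_rotField a P,
    coeFn_rotPair_fst a q P, coeFn_rotPair_snd a q P⟩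

theorem scalarPair_mem_H1Scalar (a : ℝ) (q : ℝ≥0∞) [Fact (1 ≤ q)] (P : Poly) :
    scalarPair a q P ∈ H1Scalar a q :=
  Submodule.le_topologicalClosure _ ⟨fun x => ev x P, contDiff_ev P, coeFn_contLp a q (continuous_ev P),
    coeFn_scalarPair_snd a q P⟩

theorem inner_surfaceGrad (a : ℝ) (Φ : E3 → ℝ) {x v : E3} (h : ⟪x, v⟫ = 0) :
    ⟪v, surfaceGrad a Φ x⟫ = fderiv ℝ Φ x v := by
  rw [surfaceGrad, tangentProj_apply, inner_sub_right, inner_smul_right, inner_smul_right,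
    real_inner_comm x v, h, mul_zero, mul_zero, sub_zero, real_inner_comm, gradient,
    InnerProductSpace.toDual_symm_apply]

/-- A continuous functional that vanishes on smooth fields vanishes on `H¹_q`. -/
theorem H1_induction {a : ℝ} {q : ℝ≥0∞} [Fact (1 ≤ q)]
    (Λ : Lp E3 q (area a) × Lp T3 q (area a) →L[ℝ] ℝ)
    (h : ∀ (p : Lp E3 q (area a) × Lp T3 q (area a)) (U : E3 → E3), IsSmoothField a U →
      p.1 =ᵐ[area a] U → p.2 =ᵐ[area a] covDeriv a U → Λ p = 0)
    {p : Lp E3 q (area a) × Lp T3 q (area a)} (hp : p ∈ H1 a q) : Λ p = 0 := by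
  have hle : H1 a q ≤ Λ.ker := Submodule.topologicalClosure_minimal _
    (fun r ⟨U, hU, h1, h2⟩ => h r U hU h1 h2) Λ.isClosed_ker
  exact hle hp

theorem coeFn_coriolis {a : ℝ} {q : ℝ≥0∞} (ω : ℝ) (u : Lp E3 q (area a)) :
    coriolis a ω q u =ᵐ[area a] fun x => coriolisAt a ω x (u x) := MemLp.coeFn_toLp _

/-! ### Testing Sobolev fields with rotational fields -/

section Sobolev

variable {a : ℝ} {q q' : ℝ≥0∞} [Fact (1 ≤ q)] [Fact (1 ≤ q')] [q.HolderConjugate q']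

theorem fieldPairing_rotPair_grad (P : Poly) {φ : Lp ℝ q' (area a) × Lp E3 q' (area a)}
    (hφ : φ ∈ H1Scalar a q') : fieldPairing a q q' (rotPair a q P).1 φ.2 = 0 := by
  let Λ : Lp ℝ q' (area a) × Lp E3 q' (area a) →L[ℝ] ℝ :=
    fieldPairing a q q' (rotPair a q P).1 ∘L ContinuousLinearMap.snd ℝ _ _
  have hle : H1Scalar a q' ≤ Λ.ker := by
    refine Submodule.topologicalClosure_minimal _ ?_ Λ.isClosed_ker
    rintro r ⟨Φ, hΦ, -, h2⟩
    change fieldPairing a q q' (rotPair a q P).1 r.2 = 0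
    rw [fieldPairing_congr (coeFn_rotPair_fst a q P) h2, ← integral_fderiv_rotField a P hΦ]
    congr 1
    funext x
    exact inner_surfaceGrad a Φ (inner_rotField_self P x)
  exact hle hφ

theorem rotPair_mem_H1Sol (P : Poly) : rotPair a q P ∈ H1Sol a q q' := by
  -- A rotational field is its own Helmholtz projection, with ψ = 0.
  refine ⟨rotPair_mem_H1 a q P, ((rotPair a q P).1, (rotPair a q P).1), ⟨?_, 0, zero_mem _, ?_,
    fun φ hφ => ?_⟩, rfl⟩
  · change ∀ᵐ x ∂(area a), ⟪x, (rotPair a q P).1 x⟫ = 0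
    filter_upwards [coeFn_rotPair_fst a q P] with x hx
    rw [hx, inner_rotField_self]
  · simp
  · simpa using (fieldPairing_rotPair_grad P hφ).symm

theorem fieldPairing_grad_of_mem_LqSol {u : Lp E3 q (area a)} (hu : u ∈ LqSol a q q')
    {φ : Lp ℝ q' (area a) × Lp E3 q' (area a)} (hφ : φ ∈ H1Scalar a q') :
    fieldPairing a q q' u φ.2 = 0 := by
  obtain ⟨⟨w, _⟩, ⟨-, ψ, -, h1, h2⟩, rfl⟩ := hu
  simp only at h1 h2
  rw [LinearMap.snd_apply, h1, map_sub, sub_apply, h2 φ hφ, sub_self]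

/-- Pairing x · u with a polynomial is continuous in u and gives zero for smooth tangential fields,
hence on their closure. -/
theorem ae_tangent_of_mem_H1 (q' : ℝ≥0∞) [Fact (1 ≤ q')] [q.HolderConjugate q'] (ha : 0 < a) {p : Lp E3 q (area a) × Lp T3 q (area a)}
    (hp : p ∈ H1 a q) : ∀ᵐ x ∂(area a), ⟪x, p.1 x⟫ = 0 := by
  have hint (P : Poly) : ∫ x, ⟪p.1 x, polyField (fun k => X k * P) x⟫ ∂(area a) = 0 := by
    have hc : Continuous (polyField fun k => X k * P) := continuous_polyField _
    have h := H1_induction ((fieldPairing a q q').flip (contLp a q' hc) ∘L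
      ContinuousLinearMap.fst ℝ _ _) ?_ hp
    · rw [← h]
      exact (fieldPairing_congr Filter.EventuallyEq.rfl (coeFn_contLp a q' hc)).symm
    · intro r U hU h1 _
      refine (fieldPairing_congr h1 (coeFn_contLp a q' hc)).trans ?_
      refine integral_eq_zero_of_ae ?_
      filter_upwards [ae_mem_sphere_of_pos ha] with x hx
      have h3 := hU.tangent x hx
      rw [inner_eq_sum] at h3
      simp only [inner_polyField, map_mul, ev_X, Pi.zero_apply]
      rw [← zero_mul (ev x P), ← h3, Finset.sum_mul]
      exact Finset.sum_congr rfl fun k _ => by ring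
  refine ae_eq_zero_of_integral_ev_eq_zero ?_ fun P => ?_
  · have := integrable_inner_polyField (integrable_coeFn p.1) (fun k => X k)
    refine this.congr (Filter.Eventually.of_forall fun x => ?_)
    simp only [inner_polyField]
    rw [inner_eq_sum]
    exact Finset.sum_congr rfl fun k _ => by rw [ev_X, mul_comm]
  · rw [← hint P]
    refine integral_congr_ae (Filter.Eventually.of_forall fun x => ?_)
    simp only [inner_polyField, map_mul, ev_X]
    rw [inner_eq_sum, Finset.sum_mul]
    exact Finset.sum_congr rfl fun k _ => by ring

theorem isSolenoidal_of_mem_H1Sol (ha : 0 < a) {p : Lp E3 q (area a) × Lp T3 q (area a)}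
    (hp : p ∈ H1Sol a q q') : IsSolenoidal a p.1 where
  integrable := integrable_coeFn p.1
  tangent := ae_tangent_of_mem_H1 q' ha hp.1
  divFree P := by
    rw [fieldFunctional_apply,
      ← fieldPairing_grad_of_mem_LqSol hp.2 (scalarPair_mem_H1Scalar a q' P)]
    rw [LinearMap.fst_apply,
      fieldPairing_congr Filter.EventuallyEq.rfl (coeFn_scalarPair_snd a q' P)]
    refine integral_congr_ae ?_
    filter_upwards [ae_tangent_of_mem_H1 q' ha hp.1] with x hx
    rw [inner_surfaceGrad a _ hx, fderiv_ev, inner_polyField]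
    rfl

/-- The covariant derivative of an element of `H¹_q` is determined by the field. -/
theorem snd_eq_zero_of_mem_H1 (q' : ℝ≥0∞) [Fact (1 ≤ q')] [q.HolderConjugate q'] (ha : 0 < a) {p : Lp E3 q (area a) × Lp T3 q (area a)}
    (hp : p ∈ H1 a q) (h0 : p.1 = 0) : p.2 = 0 := by
  have hint (S : Fin 3 → Fin 3 → Poly) :
      ∫ x, ⟪p.2 x, polyTensor S x⟫ ∂(area a) = 0 := by
    let W : Fin 3 → Poly := fun k => -surfaceDiv (a ^ 2)⁻¹ (tangentialPart a S k)
    have hW : Continuous (polyField W) := continuous_polyField _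
    -- The functional ∫ ∇u : S - ∫ u · W vanishes on smooth fields by parts, hence on all of `H1`.
    have h := H1_induction ((tensorPairing a q q').flip (contLp a q' (continuous_polyTensor S)) ∘L
      ContinuousLinearMap.snd ℝ _ _ - (fieldPairing a q q').flip (contLp a q' hW) ∘L
      ContinuousLinearMap.fst ℝ _ _) ?_ hp
    · have h2 : tensorPairing a q q' p.2 (contLp a q' (continuous_polyTensor S))
          - fieldPairing a q q' p.1 (contLp a q' hW) = 0 := h
      rw [h0, map_zero, zero_apply, sub_zero] at h2
      rw [← h2]
      exact (tensorPairing_congr Filter.EventuallyEq.rfl (coeFn_contLp a q' _)).symm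
    · intro r U hU h1 h2
      change tensorPairing a q q' r.2 _ - fieldPairing a q q' r.1 _ = 0
      rw [tensorPairing_congr h2 (coeFn_contLp a q' _), fieldPairing_congr h1 (coeFn_contLp a q' _),
        integral_covDeriv_polyTensor ha S hU.smooth, sub_self]
  have key : ∀ ij : Fin 3 × Fin 3, ∀ᵐ x ∂(area a), p.2 x ij = 0 := by
    intro ij
    refine ae_eq_zero_of_integral_ev_eq_zero
      ((EuclideanSpace.proj (𝕜 := ℝ) ij : T3 →L[ℝ] ℝ).integrable_comp
        (integrable_coeFn p.2)) fun P => ?_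
    rw [← hint fun k l => if (k, l) = ij then P else 0]
    refine integral_congr_ae (Filter.Eventually.of_forall fun x => ?_)
    simp only [polyTensor, PiLp.inner_apply]
    rw [Finset.sum_eq_single ij]
    · simp [mul_comm]
    · intro b _ hb
      simp [hb]
    · simp
  refine Lp.ext ?_
  filter_upwards [ae_all_iff.2 key, Lp.coeFn_zero T3 q (area a)] with x hx h0
  rw [h0]
  exact PiLp.ext hx

theorem inner_symPart_symPart (S T : T3) : ⟪symPart S, symPart T⟫ = ⟪S, symPart T⟫ := by
  simp only [inner_tensor_eq_sum, symPart_apply, Fin.sum_univ_three]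
  ring

theorem ev_tangentialPart_of_tangential {S : Fin 3 → Fin 3 → Poly} {x : E3}
    (h1 : ∀ k, ev x (∑ l, X l * S k l) = 0) (h2 : ∀ k l, S k l = S l k) (k l : Fin 3) :
    ev x (tangentialPart a S k l) = ev x (S k l) := by
  have e1 (k : Fin 3) : ∑ l, x l * ev x (S k l) = 0 := by simpa using h1 k
  have e2 (l : Fin 3) : ∑ k, x k * ev x (S k l) = 0 := by
    rw [← e1 l]
    exact Finset.sum_congr rfl fun k _ => by rw [h2]
  have e3 : ev x (tangentialPart a S k l) = ev x (S k l)
      - (a ^ 2)⁻¹ * (x k * ∑ i, x i * ev x (S i l)) - (a ^ 2)⁻¹ * (x l * ∑ j, x j * ev x (S k j))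
      + ((a ^ 2)⁻¹) ^ 2 * (x k * x l * ∑ i, x i * ∑ j, x j * ev x (S i j)) := by
    simp only [tangentialPart, projEntry, map_sum, map_mul, map_sub, ev_C, ev_X]
    simp only [Fin.sum_univ_three]
    fin_cases k <;> fin_cases l <;> simp <;> ring
  rw [e3]
  simp [e1, e2]

/-- The second tensor is symmetric and tangential, so it sees all of ∇U and no projections, and
`ev_surfaceDiv_rotDeformation` gives its divergence. The 2 in the constant arises because
`rotDeformation` is twice the deformation tensor. -/
theorem integral_symPart_covDeriv_rotField (ha : 0 < a) {U : E3 → E3} (hU : IsSmoothField a U)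
    (P : Poly) :
    ∫ x, ⟪symPart (covDeriv a U x), symPart (covDeriv a (rotField P) x)⟫ ∂(area a)
      = -(2 * a ^ 2)⁻¹ * ∫ x, ⟪U x, rotField (lieSq P + (2 : ℝ) • P) x⟫ ∂(area a) := by
  let S := rotDeformation (a ^ 2)⁻¹ P
  have hS : ∀ k, ∀ x ∈ sphere (0 : E3) a, ev x (∑ l, X l * S k l) = 0 := by
    intro k x hx
    rw [sum_mul_rotDeformation, map_mul, map_sub, map_mul, ev_C, ev_rsq_of_mem_sphere hx, map_one,
      inv_mul_cancel₀ (by positivity), sub_self, zero_mul]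
  have hSs : ∀ k l, S k l = S l k := by
    intro k l
    simp only [S, rotDeformation]
    ring
  have h1 : ∫ x, ⟪symPart (covDeriv a U x), symPart (covDeriv a (rotField P) x)⟫ ∂(area a)
      = 2⁻¹ * ∫ x, ∑ k, ∑ l, ev x (S k l) * partialD U x k l ∂(area a) := by
    rw [← integral_const_mul]
    refine integral_congr_ae ?_
    filter_upwards [ae_mem_sphere_of_pos ha] with x hx
    have h2 : symPart (covDeriv a (rotField P) x) = (2⁻¹ : ℝ) • polyTensor S x := by
      refine PiLp.ext fun ij => ?_
      exact symPart_covDeriv_rotField a P ij.1 ij.2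
    rw [inner_symPart_symPart, h2, inner_smul_right, inner_covDeriv_polyTensor a hU.smooth]
    simp only [ev_tangentialPart_of_tangential (fun k => hS k x hx) hSs]
  rw [h1, integral_sum_partialD ha hS hU.smooth, mul_inv, neg_mul, mul_assoc,
    ← integral_const_mul (a ^ 2)⁻¹, mul_neg]
  congr 2
  refine integral_congr_ae ?_
  filter_upwards [ae_mem_sphere_of_pos ha] with x hx
  simp only [S, ev_surfaceDiv_rotDeformation ha (ev_rsq_of_mem_sphere hx), rotField,
    inner_polyField, Finset.mul_sum]
  exact Finset.sum_congr rfl fun k _ => by ring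

/-- The weak Stokes operator tested with rotational fields. -/
theorem tensorPairing_symPart_rotPair (ha : 0 < a) {p : Lp E3 q (area a) × Lp T3 q (area a)}
    (hp : p ∈ H1 a q) (P : Poly) :
    tensorPairing a q q' (symPart.compLpL q (area a) p.2)
        (symPart.compLpL q' (area a) (rotPair a q' P).2)
      = -(2 * a ^ 2)⁻¹ * fieldFunctional (integrable_coeFn p.1)
        (polyRot (lieSq P + (2 : ℝ) • P)) := by
  have hsym (r : ℝ≥0∞) [Fact (1 ≤ r)] (T : Lp T3 r (area a)) (V : E3 → T3) (h : T =ᵐ[area a] V) :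
      symPart.compLpL r (area a) T =ᵐ[area a] fun x => symPart (V x) := by
    filter_upwards [symPart.coeFn_compLpL T, h] with x h1 h2
    rw [h1, h2]
  have hc := continuous_polyField (polyRot (lieSq P + (2 : ℝ) • P))
  have h := H1_induction ((tensorPairing a q q').flip
      (symPart.compLpL q' (area a) (rotPair a q' P).2) ∘L symPart.compLpL q (area a) ∘L
      ContinuousLinearMap.snd ℝ _ _ + (2 * a ^ 2)⁻¹ • (fieldPairing a q q').flip
      (contLp a q' hc) ∘L ContinuousLinearMap.fst ℝ _ _) ?_ hp
  · have h2 : tensorPairing a q q' (symPart.compLpL q (area a) p.2)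
        (symPart.compLpL q' (area a) (rotPair a q' P).2)
        + (2 * a ^ 2)⁻¹ * fieldPairing a q q' p.1 (contLp a q' hc) = 0 := h
    rw [fieldPairing_congr Filter.EventuallyEq.rfl (coeFn_contLp a q' hc)] at h2
    rw [fieldFunctional_apply]
    linarith
  · intro r U hU h1 h2
    change tensorPairing a q q' (symPart.compLpL q (area a) r.2) _
      + (2 * a ^ 2)⁻¹ * fieldPairing a q q' r.1 (contLp a q' hc) = 0
    rw [fieldPairing_congr h1 (coeFn_contLp a q' hc),
      tensorPairing_congr (hsym q _ _ h2) (hsym q' _ _ (coeFn_rotPair_snd a q' P)),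
      integral_symPart_covDeriv_rotField ha hU, rotField_eq]
    ring

/-! ### The Coriolis term -/

/-- For tangential v, (x × v) · (x × ∇P) = a² v · ∇P. -/
theorem inner_coriolisAt_rotField (ha : 0 < a) (ω : ℝ) {x v : E3} (hx : x ∈ sphere (0 : E3) a)
    (hv : ⟪x, v⟫ = 0) (P : Poly) : ⟪coriolisAt a ω x v, rotField P x⟫
      = -(2 * ω) * ⟪v, polyField (fun k => X 2 * pderiv k P) x⟫ := by
  have e1 := ev_rsq_of_mem_sphere hx
  simp only [rsq_eq, map_add, map_mul, ev_X] at e1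
  simp only [inner_eq_sum, Fin.sum_univ_three] at hv
  simp only [inner_eq_sum, coriolisAt, rotK, cross, rotField, polyField, lie_zero, lie_one, lie_two,
    Fin.sum_univ_three, map_sub, map_mul, ev_X, cross_apply]
  have hb : a⁻¹ ^ 2 * a ^ 2 = 1 := by field_simp
  simp
  linear_combination (-2 * ω * x 2 * a⁻¹ ^ 2 * (v 0 * ev x (pderiv 0 P) + v 1 * ev x (pderiv 1 P)
    + v 2 * ev x (pderiv 2 P))) * e1 + (2 * ω * x 2 * a⁻¹ ^ 2 * (x 0 * ev x (pderiv 0 P)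
    + x 1 * ev x (pderiv 1 P) + x 2 * ev x (pderiv 2 P))) * hv
    - (2 * ω * x 2 * (v 0 * ev x (pderiv 0 P) + v 1 * ev x (pderiv 1 P)
    + v 2 * ev x (pderiv 2 P))) * hb

/-- Write z ∇P = ∇(zP) - P e_z; the gradient drops out against a divergence-free field. -/
theorem fieldPairing_coriolis_rotPair (ha : 0 < a) (ω : ℝ) {u : Lp E3 q (area a)}
    (hu : IsSolenoidal a u) (P : Poly) :
    fieldPairing a q q' (coriolis a ω q u) (rotPair a q' P).1
      = 2 * ω * fieldFunctional hu.integrable (Pi.single 2 P) := by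
  have h1 : (fun k => X 2 * pderiv k P : Fin 3 → Poly)
      = polyGrad (X 2 * P) - Pi.single 2 P := by
    funext k
    fin_cases k <;> simp [polyGrad_apply, Derivation.leibniz, MvPolynomial.pderiv_X]
  have h2 : fieldPairing a q q' (coriolis a ω q u) (rotPair a q' P).1
      = -(2 * ω) * fieldFunctional hu.integrable (fun k => X 2 * pderiv k P) := by
    rw [fieldPairing_congr (coeFn_coriolis ω u) (coeFn_rotPair_fst a q' P), fieldFunctional_apply,
      ← integral_const_mul]
    refine integral_congr_ae ?_
    filter_upwards [ae_mem_sphere_of_pos ha, hu.tangent] with x hx hv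
    exact inner_coriolisAt_rotField ha ω hx hv P
  rw [h2, h1, map_sub, hu.divFree]
  ring

/-- The projection changes f by a gradient, to which v is orthogonal. `hf` excludes the default
value 0. -/
theorem fieldPairing_helmholtzProj {f : Lp E3 q (area a)}
    (hf : ∃ w, (f, w) ∈ helmholtzGraph a q q') {v : Lp E3 q' (area a)} (hv : v ∈ LqSol a q' q) :
    fieldPairing a q q' (helmholtzProj a q q' f) v = fieldPairing a q q' f v := by
  obtain ⟨-, ψ, hψ, h1, -⟩ := hf.choose_spec
  simp only at h1
  rw [helmholtzProj, dif_pos hf, h1, map_sub, sub_apply, fieldPairing_comm ψ.2,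
    fieldPairing_grad_of_mem_LqSol hv hψ, sub_zero]

theorem gradient_ev (P : Poly) (x : E3) :
    gradient (fun x => ev x P) x = polyField (polyGrad P) x := by
  refine ext_inner_left ℝ fun v => ?_
  rw [inner_polyField, real_inner_comm, gradient, InnerProductSpace.toDual_symm_apply, fderiv_ev]
  rfl

/-- For the rotation field x × c the Coriolis term is 2ωz grad(c · x). It differs from the gradient
of ωz(c · x) by ω(z c - (c · x) e_z) = ω x × (c × e_z), again a rotation field: an explicit
Helmholtz decomposition. -/
theorem coriolisAt_rotField (ha : 0 < a) (ω : ℝ) (c : Fin 3 → ℝ) {x : E3}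
    (hx : x ∈ sphere (0 : E3) a) : coriolisAt a ω x (rotField (∑ j, c j • X j) x)
      = surfaceGrad a (fun x => ev x (ω • (X 2 * ∑ j, c j • X j))) x
        + rotField (ω • (c 1 • X 0 - c 0 • X 1)) x := by
  have e1 := ev_rsq_of_mem_sphere hx
  simp only [rsq_eq, map_add, map_mul, ev_X] at e1
  have hb : a⁻¹ ^ 2 * a ^ 2 = 1 := by field_simp
  refine PiLp.ext fun i => ?_
  rw [surfaceGrad, gradient_ev, tangentProj_apply, inner_polyField]
  simp only [coriolisAt, rotK, cross, rotField, polyField, Fin.sum_univ_three, cross_apply]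
  fin_cases i <;> simp [polyGrad_apply, lie_zero, lie_one, lie_two, Derivation.leibniz,
    MvPolynomial.pderiv_X]
  · linear_combination 2 * ω * x 2 * c 0 * (a⁻¹ ^ 2 * e1 + hb)
  · linear_combination 2 * ω * x 2 * c 1 * (a⁻¹ ^ 2 * e1 + hb)
  · linear_combination 2 * ω * x 2 * c 2 * (a⁻¹ ^ 2 * e1 + hb)

theorem exists_helmholtzGraph_coriolis (ha : 0 < a) (ω : ℝ) {u : Lp E3 q (area a)} {Q : Poly}
    (hQ : Q.IsHomogeneous 1) (hu : u =ᵐ[area a] rotField Q) :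
    ∃ w, (coriolis a ω q u, w) ∈ helmholtzGraph a q q' := by
  obtain ⟨c, rfl⟩ := exists_eq_sum_smul_X hQ
  let G : Poly := ω • (X 2 * ∑ j, c j • X j)
  let R : Poly := ω • (c 1 • X 0 - c 0 • X 1)
  have h1 : coriolis a ω q u = (scalarPair a q G).2 + (rotPair a q R).1 := by
    refine Lp.ext ?_
    filter_upwards [coeFn_coriolis ω u, hu, Lp.coeFn_add (scalarPair a q G).2 (rotPair a q R).1,
      coeFn_scalarPair_snd a q G, coeFn_rotPair_fst a q R, ae_mem_sphere_of_pos ha]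
      with x k1 k2 k3 k4 k5 hx
    rw [k1, k2, k3, Pi.add_apply, k4, k5, coriolisAt_rotField ha ω c hx]
  refine ⟨(rotPair a q R).1, ?_, scalarPair a q G, scalarPair_mem_H1Scalar a q G, ?_,
    fun φ hφ => ?_⟩
  · change ∀ᵐ x ∂(area a), ⟪x, coriolis a ω q u x⟫ = 0
    filter_upwards [coeFn_coriolis ω u] with x hx
    rw [hx, inner_eq_sum]
    simp [coriolisAt, rotK, cross, cross_apply, Fin.sum_univ_three]
    ring
  · simp [h1]
  · simp only
    rw [h1, map_add, add_apply, fieldPairing_rotPair_grad R hφ, add_zero]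

end Sobolev

/-! ### The kernel of the Stokes-Coriolis operator -/

/-- The sign is due to x × e_z = (y, -x, 0). -/
theorem rotField_smul_X_two (c : ℝ) (x : E3) : rotField ((-c) • X 2) x = c • dTheta x := by
  refine PiLp.ext fun i => ?_
  simp only [rotField, polyField, Derivation.map_smul, map_smul]
  fin_cases i <;> simp [dTheta, lie_zero, lie_one, lie_two, MvPolynomial.pderiv_X]

theorem dTheta_eq_rotField : dTheta = rotField ((-1 : ℝ) • X 2) := by
  funext x
  rw [rotField_smul_X_two, one_smul]

theorem coeFn_dThetaPair_fst (a : ℝ) (q : ℝ≥0∞) : (dThetaPair a q).1 =ᵐ[area a] dTheta :=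
  coeFn_contLp a q contDiff_dTheta.continuous

theorem coeFn_dThetaPair_snd (a : ℝ) (q : ℝ≥0∞) :
    (dThetaPair a q).2 =ᵐ[area a] covDeriv a dTheta :=
  coeFn_contLp a q (continuous_covDeriv a contDiff_dTheta)

theorem dThetaPair_eq_rotPair (a : ℝ) (q : ℝ≥0∞) :
    dThetaPair a q = rotPair a q ((-1 : ℝ) • X 2) := by
  refine Prod.ext (Lp.ext ?_) (Lp.ext ?_)
  · refine (coeFn_dThetaPair_fst a q).trans ?_
    rw [dTheta_eq_rotField]
    exact (coeFn_rotPair_fst a q _).symm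
  · refine (coeFn_dThetaPair_snd a q).trans ?_
    rw [dTheta_eq_rotField]
    exact (coeFn_rotPair_snd a q _).symm

/-- For an axis parallel to e_z the rotational part in `coriolisAt_rotField` vanishes and only a
gradient is left. -/
theorem coriolis_smul_dTheta {a : ℝ} {q : ℝ≥0∞} (ha : 0 < a) (ω c : ℝ) {u : Lp E3 q (area a)}
    (hu : u =ᵐ[area a] fun x => c • dTheta x) :
    coriolis a ω q u = (scalarPair a q (ω • (X 2 * (-c) • X 2))).2 := by
  refine Lp.ext ?_
  filter_upwards [coeFn_coriolis ω u, hu, coeFn_scalarPair_snd a q (ω • (X 2 * (-c) • X 2)),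
    ae_mem_sphere_of_pos ha] with x k1 k2 k3 hx
  have h := coriolisAt_rotField ha ω (Pi.single 2 (-c)) hx
  have h0 : ∑ j, (Pi.single 2 (-c) : Fin 3 → ℝ) j • (X j : Poly) = (-c) • X 2 := by
    simp
  have hz : rotField (0 : Poly) x = 0 := by
    refine PiLp.ext fun i => ?_
    simp [rotField, polyField]
  rw [h0] at h
  rw [k1, k2, k3, ← rotField_smul_X_two, h]
  simp [hz]

section Kernel

variable {a : ℝ} {q q' : ℝ≥0∞} [Fact (1 ≤ q)] [Fact (1 ≤ q')] [q.HolderConjugate q']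

theorem weakStokes_apply (μs : ℝ) (u : H1Sol a q q') (v : H1Sol a q' q) :
    weakStokes a μs q q' u v = 2 * μs * tensorPairing a q q'
      (symPart.compLpL q (area a) u.1.2) (symPart.compLpL q' (area a) v.1.2) := rfl

theorem weakCoriolis_apply (ω : ℝ) (u : H1Sol a q q') (v : H1Sol a q' q) :
    weakCoriolis a ω q q' u v
      = fieldPairing a q q' (helmholtzProj a q q' (coriolis a ω q u.1.1)) v.1.1 := rfl

/-- Rotations about the `z`-axis have vanishing deformation tensor. -/
theorem symPart_covDeriv_dTheta (a : ℝ) (x : E3) : symPart (covDeriv a dTheta x) = 0 := by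
  refine PiLp.ext fun ij => ?_
  rw [dTheta_eq_rotField]
  refine (symPart_covDeriv_rotField a _ ij.1 ij.2).trans ?_
  obtain ⟨i, j⟩ := ij
  have h1 : ((-1 : ℝ) • X 2 - euler ((-1 : ℝ) • X 2) : Poly) = 0 := by
    simp [euler_apply, MvPolynomial.pderiv_X]
  rw [rotDeformation, h1]
  fin_cases i <;> fin_cases j <;> simp [lie_zero, lie_one, lie_two, MvPolynomial.pderiv_X]

theorem smul_dThetaPair_mem_weakKernel (ha : 0 < a) (μs ω c : ℝ) :
    c • dThetaPair a q ∈ weakKernel a μs ω q q' := by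
  have hmem : c • dThetaPair a q ∈ H1Sol a q q' := by
    rw [dThetaPair_eq_rotPair]
    exact Submodule.smul_mem _ c (rotPair_mem_H1Sol _)
  refine ⟨⟨_, hmem⟩, ?_, rfl⟩
  have hu : (c • dThetaPair a q).1 =ᵐ[area a] fun x => c • dTheta x := by
    filter_upwards [Lp.coeFn_smul c (dThetaPair a q).1, coeFn_dThetaPair_fst a q] with x h1 h2
    rw [Prod.smul_fst, h1, Pi.smul_apply, h2]
  have hD : symPart.compLpL q (area a) (c • dThetaPair a q).2 = 0 := by
    rw [Prod.smul_snd, map_smul]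
    refine smul_eq_zero_of_right _ (Lp.ext ?_)
    filter_upwards [symPart.coeFn_compLpL (dThetaPair a q).2, coeFn_dThetaPair_snd a q,
      Lp.coeFn_zero T3 q (area a)] with x h1 h2 h3
    rw [h1, h2, h3, symPart_covDeriv_dTheta]
    rfl
  have hex : ∃ w, (coriolis a ω q (c • dThetaPair a q).1, w) ∈ helmholtzGraph a q q' :=
    exists_helmholtzGraph_coriolis ha ω
      ((MvPolynomial.homogeneousSubmodule (Fin 3) ℝ 1).smul_mem (-c)
        (MvPolynomial.isHomogeneous_X ℝ 2))
      (hu.trans (Filter.Eventually.of_forall fun x => (rotField_smul_X_two c x).symm))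
  refine ContinuousLinearMap.ext fun v => ?_
  have hv : v.1.1 ∈ LqSol a q' q := v.2.2
  rw [add_apply, weakStokes_apply, weakCoriolis_apply, hD, map_zero,
    fieldPairing_helmholtzProj hex hv, coriolis_smul_dTheta ha ω c hu, fieldPairing_comm,
    fieldPairing_grad_of_mem_LqSol hv (scalarPair_mem_H1Scalar a q _)]
  simp

/-- The kernel equation tested with rotational fields. -/
theorem fieldFunctional_of_kernel (ha : 0 < a) {μs ω : ℝ} {u : H1Sol a q q'}
    (h : weakStokes a μs q q' u + weakCoriolis a ω q q' u = 0) (P : Poly) :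
    fieldPairing a q q' (helmholtzProj a q q' (coriolis a ω q u.1.1)) (rotPair a q' P).1
      = μs * (a ^ 2)⁻¹ * fieldFunctional (isSolenoidal_of_mem_H1Sol ha u.2).integrable
        (polyRot (lieSq P + (2 : ℝ) • P)) := by
  have h1 := congrArg (fun T : HNeg1Sol a q q' => T ⟨rotPair a q' P, rotPair_mem_H1Sol P⟩) h
  simp only [add_apply, weakStokes_apply, weakCoriolis_apply, zero_apply,
    tensorPairing_symPart_rotPair ha u.2.1] at h1
  rw [mul_inv] at h1
  linear_combination h1

/-- The Helmholtz projection of the Coriolis term of a kernel element exists. -/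
theorem exists_helmholtzGraph_of_kernel (ha : 0 < a) {μs ω : ℝ} (hμs : 0 < μs)
    {u : H1Sol a q q'} (h : weakStokes a μs q q' u + weakCoriolis a ω q q' u = 0) :
    ∃ w, (coriolis a ω q u.1.1, w) ∈ helmholtzGraph a q q' := by
  -- Without a decomposition `helmholtzProj` is 0 and the Coriolis term disappears: the case c = 0
  -- of the equation forces u to be a rotation field, for which a decomposition is known.
  by_contra hex
  have hsol := isSolenoidal_of_mem_H1Sol ha u.2
  have hP : helmholtzProj a q q' (coriolis a ω q u.1.1) = 0 := dif_neg hex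
  have heq : ∀ P, fieldFunctional hsol.integrable
      (polyRot (lieSq (lieSq P) + (2 : ℝ) • lieSq P + (0 : ℝ) • lie 2 P)) = 0 := by
    intro P
    have h1 := fieldFunctional_of_kernel ha h (lieSq P)
    rw [hP, map_zero, zero_apply] at h1
    rw [zero_smul, add_zero]
    exact (mul_eq_zero.1 h1.symm).resolve_left (by positivity)
  exact hex (exists_helmholtzGraph_coriolis ha ω (isHomogeneous_linearPart hsol.integrable)
    (hsol.ae_eq_rotField ha heq (zero_smul _ _)))

theorem exists_eq_smul_dThetaPair (ha : 0 < a) {μs ω : ℝ} (hμs : 0 < μs) (hω : ω ≠ 0)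
    {u : H1Sol a q q'} (h : weakStokes a μs q q' u + weakCoriolis a ω q q' u = 0) :
    ∃ c : ℝ, u.1 = c • dThetaPair a q := by
  have hsol := isSolenoidal_of_mem_H1Sol ha u.2
  have hex := exists_helmholtzGraph_of_kernel ha hμs h
  set F := fieldFunctional hsol.integrable with hF
  set c : ℝ := -(2 * ω * a ^ 2 / μs) with hc
  have hc0 : c ≠ 0 := by
    rw [hc]
    exact neg_ne_zero.2 (by positivity)
  have heq : ∀ P, F (polyRot (lieSq (lieSq P) + (2 : ℝ) • lieSq P + c • lie 2 P)) = 0 := by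
    intro P
    -- Testing with `lieSq P` instead of `P` makes the Coriolis term 2ω ∫ u_z LP a value of the
    -- rotational functional; `c` is the quotient of the two constants.
    have h1 := fieldFunctional_of_kernel ha h (lieSq P)
    have hv : (rotPair a q' (lieSq P)).1 ∈ LqSol a q' q := (rotPair_mem_H1Sol (lieSq P)).2
    rw [fieldPairing_helmholtzProj hex hv,
      fieldPairing_coriolis_rotPair ha ω hsol, fieldFunctional_single_lieSq hsol] at h1
    rw [map_add polyRot, map_add F, map_smul polyRot, map_smul F, smul_eq_mul, hc]
    field_simp at h1 ⊢
    linear_combination -h1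
  -- (L + 2)L vanishes in degree one, so only the Coriolis term remains; here ω ≠ 0 is decisive.
  have hdeg (P : Poly) (hP : P.IsHomogeneous 1) : F (polyRot (lie 2 P)) = 0 := by
    have h1 := heq P
    rw [lieSq_of_isHomogeneous_one hP, map_neg, map_smul, lieSq_of_isHomogeneous_one hP] at h1
    have h2 : -((2 : ℝ) • -((2 : ℝ) • P)) + (2 : ℝ) • -((2 : ℝ) • P) + c • lie 2 P
        = c • lie 2 P := by module
    rw [h2, map_smul, map_smul] at h1
    exact (smul_eq_zero.1 h1).resolve_left hc0
  -- `lie 2` maps y to x and x to -y, so the functional vanishes at both horizontal coordinates.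
  have h0 : F (polyRot (X 0)) = 0 := by
    have := hdeg (X 1) (MvPolynomial.isHomogeneous_X ℝ 1)
    simpa [lie_two, MvPolynomial.pderiv_X] using this
  have h1 : F (polyRot (X 1)) = 0 := by
    have := hdeg (X 0) (MvPolynomial.isHomogeneous_X ℝ 0)
    simpa [lie_two, MvPolynomial.pderiv_X] using this
  obtain ⟨κ, hκ⟩ : ∃ κ : ℝ, linearPart hsol.integrable = (-κ) • X 2 := by
    refine ⟨-(F (polyRot (X 2)) / (2 * sphereIntegral a (X 2 * X 2))), ?_⟩
    rw [linearPart, Fin.sum_univ_three, ← hF, h0, h1]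
    simp
  have hu := hsol.ae_eq_rotField ha heq (by
    rw [hκ, Derivation.map_smul]
    simp [lie_two, MvPolynomial.pderiv_X])
  rw [hκ] at hu
  refine ⟨κ, ?_⟩
  have hmem : u.1 - κ • dThetaPair a q ∈ H1 a q := by
    rw [dThetaPair_eq_rotPair]
    exact Submodule.sub_mem _ u.2.1 (Submodule.smul_mem _ κ (rotPair_mem_H1 a q _))
  have hfst : (u.1 - κ • dThetaPair a q).1 = 0 := by
    rw [Prod.fst_sub, sub_eq_zero]
    refine Lp.ext ?_
    filter_upwards [hu, Lp.coeFn_smul κ (dThetaPair a q).1, coeFn_dThetaPair_fst a q]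
      with x k1 k2 k3
    rw [k1, Prod.smul_fst, k2, Pi.smul_apply, k3, rotField_smul_X_two]
  -- The fields agree, and closability of ∇ makes the second components agree too.
  exact sub_eq_zero.1 (Prod.ext hfst (snd_eq_zero_of_mem_H1 q' ha hmem hfst))

end Kernel

end SphereFlow

end

theorem lemma3p1 (a μs ω : ℝ) (ha : 0 < a) (hμs : 0 < μs) (hω : ω ≠ 0)
    (q q' : ℝ≥0∞) (hq : 1 < q) (hq_top : q < ⊤) [Fact (1 ≤ q)] [Fact (1 ≤ q')]
    [q.HolderConjugate q'] :
    SphereFlow.weakKernel a μs ω q q' = SphereFlow.equilibria a q := by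
  ext p
  constructor
  · rintro ⟨u, hu, rfl⟩
    exact SphereFlow.exists_eq_smul_dThetaPair ha hμs hω hu
  · rintro ⟨c, rfl⟩
    exact SphereFlow.smul_dThetaPair_mem_weakKernel ha μs ω c
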